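/- For $n\ge 1$ let $\mathbb{T}^n=\mathbb{R}^n/(2\pi\mathbb{Z})^n$ be the torus with its Euclidean metric, $\Delta$ its Laplacian and $dx$ its Lebesgue measure (of total mass $(2\pi)^n$). (1) Let $n\ge 2$ and let $\omega\subset\mathbb{T}^n$ be a nonempty open set. Then there exists a constant $c_\omega>0$ such that, for every $\lambda\ge 0$ and every smooth function $\psi_\lambda:\mathbb{T}^n\to\mathbb{C}$ with $$-\Delta\psi_\lambda=\lambda^2\psi_\lambda,\qquad \|\psi_\lambda\|_{L^2(\mathbb{T}^n)}=1,$$ one has $$\int_\omega|\psi_\lambda(x)|^2\,dx\ \ge\ c_\omega .$$ (2) For $h>0$ and $a\in C_c^\infty(T^*\mathbb{T}^2)$, where $T^*\mathbb{T}^2=\mathbb{T}^2\times\mathbb{R}^2$, let $$\mathrm{Op}_h(a)u(x)=\frac{1}{(2\pi h)^2}\int_{\mathbb{R}^2}\int_{\mathbb{R}^2}a\Big(\frac{x+y}{2},\xi\Big)e^{\frac{i}{h}\langle x-y,\xi\rangle}u(y)\,d\xi\,dy$$ be the Weyl quantization of $a$, acting on $2\pi\mathbb{Z}^2$-periodic functions.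 A semiclassical measure is a distribution $\mu\in\mathcal{D}'(T^*\mathbb{T}^2)$ for which there are $h_j\to0^+$ and smooth $\psi_j$ on $\mathbb{T}^2$ with $-h_j^2\Delta\psi_j=\psi_j$, $\|\psi_j\|_{L^2}=1$ and $$\langle\psi_j,\mathrm{Op}_{h_j}(a)\psi_j\rangle_{L^2(\mathbb{T}^2)}\longrightarrow\langle\mu,a\rangle\qquad\text{for every }a\in C_c^\infty(T^*\mathbb{T}^2).$$ Let $\mathcal{M}(\Delta)$ be the set of all semiclassical measures, and let $\omega\subset\mathbb{T}^2$ be a nonempty open set. Then there exists a constant $c_\omega>0$ such that every $\mu\in\mathcal{M}(\Delta)$ is given by a Borel probability measure on $T^*\mathbb{T}^2$ carried by $\mathbb{T}^2\times\mathbb{S}^1$, and $$\mu(\omega\times\mathbb{S}^1)\ \ge\ c_\omega .$$ -/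

import Mathlib

open MeasureTheory Filter Topology
open scoped ContDiff

noncomputable section

namespace FlatTorus

/-- The circle `ℝ / 2πℤ` has positive length. -/
instance factTwoPiPos : Fact (0 < 2 * Real.pi) := ⟨Real.two_pi_pos⟩

/-- Euclidean space `ℝⁿ`. -/
abbrev Euc (n : ℕ) : Type := EuclideanSpace ℝ (Fin n)

/-- The torus `𝕋ⁿ = ℝⁿ / (2πℤ)ⁿ`.  Its `volume` is the product of the arc length measures, of
total mass `(2π)ⁿ`. -/
abbrev Torus (n : ℕ) : Type := Fin n → AddCircle (2 * Real.pi)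

/-- The cotangent bundle `T*𝕋ⁿ = 𝕋ⁿ × ℝⁿ`. -/
abbrev Cotangent (n : ℕ) : Type := Torus n × Euc n

/-- The projection `ℝⁿ → 𝕋ⁿ`, a local isometry for the flat metric. -/
def proj {n : ℕ} (x : Euc n) : Torus n := fun i => (x i : AddCircle (2 * Real.pi))

/-- The `2πℤⁿ`-periodic function on `ℝⁿ` given by a function on the torus. -/
def lift {n : ℕ} (ψ : Torus n → ℂ) : Euc n → ℂ := fun x => ψ (proj x)

/-- `ψ` is a smooth function on the flat torus with `-Δψ = lam² ψ` and `‖ψ‖_{L²} = 1`. -/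
structure IsNormalizedEigenfunction {n : ℕ} (lam : ℝ) (ψ : Torus n → ℂ) : Prop where
  smooth : ContDiff ℝ ∞ (lift ψ)
  eigen : ∀ x : Euc n, -(Laplacian.laplacian (lift ψ) x) = (lam : ℂ) ^ 2 * lift ψ x
  normalized : ∫ x : Torus n, ‖ψ x‖ ^ 2 = 1

/-- A function on `T*𝕋ⁿ`, seen as a function on `ℝⁿ × ℝⁿ` periodic in the first variable. -/
def liftSymbol {n : ℕ} (a : Cotangent n → ℂ) : Euc n × Euc n → ℂ := fun p => a (proj p.1, p.2)

/-- The space `C_c^∞(T*𝕋ⁿ)` of smooth compactly supported symbols. -/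
def TestFunctions (n : ℕ) : Submodule ℂ (Cotangent n → ℂ) where
  carrier := {a | ContDiff ℝ ∞ (liftSymbol a) ∧ HasCompactSupport a}
  zero_mem' := ⟨contDiff_const, HasCompactSupport.zero⟩
  add_mem' := fun ha hb => ⟨ha.1.add hb.1, ha.2.add hb.2⟩
  smul_mem' := fun c _ ha => ⟨contDiff_const.smul ha.1, ha.2.smul_left (f := fun _ => c)⟩

/-- A linear functional on `C_c^∞(T*𝕋ⁿ)` is a distribution if, on the functions supported in
a given compact set, it is bounded by finitely many derivatives. -/
def IsDistribution {n : ℕ} (μ : TestFunctions n →ₗ[ℂ] ℂ) : Prop :=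
  ∀ K : Set (Cotangent n), IsCompact K → ∃ (N : ℕ) (C : ℝ), ∀ a : TestFunctions n,
    tsupport (a : Cotangent n → ℂ) ⊆ K → ∀ B : ℝ,
      (∀ j ≤ N, ∀ p : Euc n × Euc n, ‖iteratedFDeriv ℝ j (liftSymbol a) p‖ ≤ B) → ‖μ a‖ ≤ C * B

/-- The Weyl quantization
`Op_h(a)u(x) = (2πh)⁻ⁿ ∬ a((x+y)/2, ξ) exp(i⟨x-y,ξ⟩/h) u(y) dξ dy`
of a symbol on `T*𝕋ⁿ`, acting on periodic functions on `ℝⁿ`.  For `a` in `C_c^∞(T*𝕋ⁿ)`, the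
integral over `ξ` is rapidly decreasing in `x - y`, so both integrals converge absolutely. -/
def weylOp {n : ℕ} (h : ℝ) (a : Cotangent n → ℂ) (u : Euc n → ℂ) (x : Euc n) : ℂ :=
  (((2 * Real.pi * h) ^ n)⁻¹ : ℝ) *
    ∫ y : Euc n,
      (∫ ξ : Euc n, a (proj ((1 / 2 : ℝ) • (x + y)), ξ) *
        Complex.exp (Complex.I * ((inner ℝ (x - y) ξ / h : ℝ) : ℂ))) * u y

/-- The fundamental domain `(0, 2π]ⁿ` of the torus. -/
def box (n : ℕ) : Set (Euc n) := {x | ∀ i, x i ∈ Set.Ioc 0 (2 * Real.pi)}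

/-- The Wigner distribution `a ↦ ⟨ψ, Op_h(a)ψ⟩` of `ψ ∈ L²(𝕋ⁿ)`. -/
def wigner {n : ℕ} (h : ℝ) (ψ : Torus n → ℂ) (a : Cotangent n → ℂ) : ℂ :=
  ∫ x in box n, (starRingEnd ℂ) (lift ψ x) * weylOp h a (lift ψ) x

/-- The set `M(Δ)` of semiclassical measures of the flat torus: the distributions on `T*𝕋ⁿ` that
are limits of the Wigner distributions of normalized solutions of `-h²Δψ = ψ`, along a
sequence `h → 0⁺`. -/
def semiclassicalMeasures (n : ℕ) : Set (TestFunctions n →ₗ[ℂ] ℂ) :=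
  {μ | IsDistribution μ ∧ ∃ (h : ℕ → ℝ) (ψ : ℕ → Torus n → ℂ),
    (∀ j, 0 < h j) ∧ Tendsto h atTop (𝓝 0) ∧
    (∀ j, IsNormalizedEigenfunction (h j)⁻¹ (ψ j)) ∧
    ∀ a : TestFunctions n, Tendsto (fun j => wigner (h j) (ψ j) a) atTop (𝓝 (μ a))}

/-- The Borel probability measure `m` on `T*𝕋ⁿ` is carried by the unit cosphere bundle
`S*𝕋ⁿ = 𝕋ⁿ × 𝕊ⁿ⁻¹` and represents the distribution `μ`. -/
structure Represents {n : ℕ} (m : Measure (Cotangent n)) (μ : TestFunctions n →ₗ[ℂ] ℂ) :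
    Prop where
  probability : IsProbabilityMeasure m
  carried : m (Set.univ ×ˢ Metric.sphere (0 : Euc n) 1)ᶜ = 0
  integral_eq : ∀ a : TestFunctions n, μ a = ∫ z, (a : Cotangent n → ℂ) z ∂m

end FlatTorus

end

/-! An eigenfunction with eigenvalue `lam ^ 2` is a trigonometric polynomial whose frequencies are
lattice points on the sphere of radius `lam`, so part (1) is an observability estimate for such
polynomials, uniform in the radius.

The arithmetic input is that a chain of lattice points on one sphere with steps at most `M` (a
`Linked` set) has diameter bounded independently of the radius (`exists_diam_bound`). Suppose
lattice points in a bounded region lie on a sphere of any radius. After translating one of them to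
the origin, their differences form one of finitely many sets, and each such set determines the slice
of the sphere by their affine span. That slice is therefore bounded (`exists_bound_of_mem_span`),
and induction on the affine rank follows.

Observability is also proved by induction on the affine rank (`exists_observability_of_affRank_lt`).
The weight is replaced by a trigonometric polynomial of degree at most `M`, whose quadratic form
does not couple frequencies at distance greater than `M`. If some linked subset has full rank, all
frequencies lie in a ball of bounded radius; after modulation only a fixed finite set of frequencies
is left, and analyticity and compactness conclude. Otherwise the linked pieces have smaller rank,
the form is additive over them, and the induction hypothesis applies to each.

For part (2), `wigner_trigPoly` expresses the Wigner distribution through the Fourier coefficients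
of the symbol in position, taken at frequency differences and at midpoint momenta. Clusters at
distance greater than `N` have diameter at most `D N`. If `h * D N` tends to zero, each cluster is
concentrated near one momentum, and interactions between clusters involve only the tail of the
coefficients. So the Wigner distribution is asymptotic to a positive measure, the sum of the cluster
densities placed at their momenta. Observability bounds the mass of each cluster over the open set
from below, and weak compactness of probability measures on the cosphere bundle gives the limit. -/

noncomputable section

namespace FlatTorus

open scoped ComplexConjugate

/-! ### Fourier modes on the torus, density and Parseval. -/

section Modes

variable {n : ℕ}

/-- The Fourier mode `exp(i⟨k,x⟩)` on the torus. -/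
def mode (k : Fin n → ℤ) : C(Torus n, ℂ) where
  toFun x := ∏ i, fourier (k i) (x i)
  continuous_toFun := by fun_prop

/-- The inclusion of the lattice `ℤⁿ` in `ℝⁿ`. -/
def emb (k : Fin n → ℤ) : Euc n := WithLp.toLp 2 fun i => (k i : ℝ)

@[simp] lemma emb_apply (k : Fin n → ℤ) (i : Fin n) : emb k i = k i := rfl

lemma emb_sub (k l : Fin n → ℤ) : emb (k - l) = emb k - emb l := by ext i; simp

@[simp] lemma emb_zero : emb (0 : Fin n → ℤ) = 0 := by ext i; simp

lemma abs_coord_le_norm_emb (k : Fin n → ℤ) (i : Fin n) : |(k i : ℝ)| ≤ ‖emb k‖ := by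
  simpa using PiLp.norm_apply_le (emb k) i

lemma norm_emb_sub_comm (k l : Fin n → ℤ) : ‖emb (k - l)‖ = ‖emb (l - k)‖ := by
  rw [emb_sub, emb_sub, norm_sub_rev]

/-- There are finitely many lattice points in a ball. -/
lemma finite_norm_emb_le (r : ℝ) : {k : Fin n → ℤ | ‖emb k‖ ≤ r}.Finite := by
  refine (Set.finite_Icc (fun _ : Fin n => -⌈r⌉) (fun _ => ⌈r⌉)).subset ?_
  intro k hk
  have h : ∀ i, |(k i : ℝ)| ≤ r := fun i => (abs_coord_le_norm_emb k i).trans hk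
  constructor
  · intro i
    have h1 := (abs_le.1 (h i)).1
    have h2 := Int.le_ceil r
    have : (-(⌈r⌉ : ℤ) : ℝ) ≤ k i := by linarith
    exact_mod_cast this
  · intro i
    have h1 := (abs_le.1 (h i)).2
    have h2 := Int.le_ceil r
    have : (k i : ℝ) ≤ (⌈r⌉ : ℤ) := by linarith
    exact_mod_cast this

/-- The lattice points of norm at most `r`. -/
def latticeBall (n : ℕ) (r : ℝ) : Finset (Fin n → ℤ) := (finite_norm_emb_le r).toFinset

@[simp] lemma mem_latticeBall {r : ℝ} {k : Fin n → ℤ} : k ∈ latticeBall n r ↔ ‖emb k‖ ≤ r := by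
  simp [latticeBall]

lemma mode_apply (k : Fin n → ℤ) (x : Torus n) : mode k x = ∏ i, fourier (k i) (x i) := rfl

lemma mode_add (k l : Fin n → ℤ) (x : Torus n) : mode (k + l) x = mode k x * mode l x := by
  simp only [mode_apply, Pi.add_apply, fourier_add, Finset.prod_mul_distrib]

lemma mode_neg (k : Fin n → ℤ) (x : Torus n) : mode (-k) x = conj (mode k x) := by
  simp only [mode_apply, Pi.neg_apply, fourier_neg, map_prod]

@[simp] lemma mode_zero (x : Torus n) : mode (0 : Fin n → ℤ) x = 1 := by
  simp [mode_apply]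

@[simp] lemma norm_mode (k : Fin n → ℤ) (x : Torus n) : ‖mode k x‖ = 1 := by
  simp [mode_apply, norm_prod, fourier_apply, Circle.norm_coe]

lemma mode_sub (k l : Fin n → ℤ) (x : Torus n) : mode (k - l) x = mode k x * conj (mode l x) := by
  rw [sub_eq_add_neg, mode_add, mode_neg]

lemma mode_proj (k : Fin n → ℤ) (x : Euc n) :
    mode k (proj x) = Complex.exp (Complex.I * ((inner ℝ (emb k) x : ℝ) : ℂ)) := by
  simp only [mode_apply, proj, fourier_coe_apply, ← Complex.exp_sum]
  congr 1
  rw [PiLp.inner_apply]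
  push_cast
  rw [Finset.mul_sum]
  refine Finset.sum_congr rfl fun i _ => ?_
  have : (Real.pi : ℂ) ≠ 0 := by exact_mod_cast Real.pi_ne_zero
  simp
  field_simp

lemma mode_add_right (k : Fin n → ℤ) (x y : Torus n) : mode k (x + y) = mode k x * mode k y := by
  simp only [mode_apply, Pi.add_apply, ← Finset.prod_mul_distrib]
  refine Finset.prod_congr rfl fun i _ => ?_
  simp [fourier_apply, smul_add, AddCircle.toCircle_add]

lemma proj_add (x y : Euc n) : proj (x + y) = proj x + proj y := by
  funext i; simp [proj]

lemma proj_sub (x y : Euc n) : proj (x - y) = proj x - proj y := by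
  funext i; simp [proj]

@[fun_prop]
lemma continuous_proj : Continuous (proj (n := n)) := by
  refine continuous_pi fun i => ?_
  exact (AddCircle.continuous_mk' _).comp (PiLp.continuous_apply 2 _ i)

lemma isOpenMap_proj : IsOpenMap (proj (n := n)) := by
  have h1 : IsOpenMap (fun (x : Fin n → ℝ) (i : Fin n) => (x i : AddCircle (2 * Real.pi))) :=
    IsOpenMap.piMap (fun i => QuotientAddGroup.isOpenMap_coe)
      (Filter.Eventually.of_forall fun i => QuotientAddGroup.mk_surjective)
  exact h1.comp (EuclideanSpace.equiv (Fin n) ℝ).toHomeomorph.isOpenMap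

/-- The representative in the fundamental domain of a point of the torus. -/
def rep (x : Torus n) : Euc n :=
  WithLp.toLp 2 fun i => (AddCircle.equivIoc (2 * Real.pi) 0 (x i) : ℝ)

@[simp] lemma proj_rep (x : Torus n) : proj (rep x) = x := by
  funext i
  exact (AddCircle.equivIoc (2 * Real.pi) 0).symm_apply_apply (x i)

lemma proj_surjective : Function.Surjective (proj (n := n)) := fun x => ⟨rep x, proj_rep x⟩

lemma measurePreserving_proj :
    MeasurePreserving (proj (n := n)) (volume.restrict (box n)) volume := by
  have h1 : MeasurePreserving (fun (x : Fin n → ℝ) (i : Fin n) => (x i : AddCircle (2 * Real.pi)))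
      (Measure.pi fun _ : Fin n => (volume : Measure ℝ).restrict (Set.Ioc 0 (2 * Real.pi)))
      (Measure.pi fun _ => volume) := by
    refine measurePreserving_pi _ _ fun i => ?_
    have := AddCircle.measurePreserving_mk (2 * Real.pi) 0
    rwa [zero_add] at this
  have h2 := (EuclideanSpace.volume_preserving_symm_measurableEquiv_toLp (Fin n)).restrict_preimage
    (s := Set.univ.pi fun _ : Fin n => Set.Ioc 0 (2 * Real.pi))
    (MeasurableSet.univ_pi fun _ => measurableSet_Ioc)
  rw [volume_pi, Measure.restrict_pi_pi] at h2
  have h3 := h1.comp h2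
  have hbox : box n = (MeasurableEquiv.toLp 2 (Fin n → ℝ)).symm ⁻¹'
      Set.univ.pi fun _ => Set.Ioc 0 (2 * Real.pi) := by
    ext x; simp [box, Set.mem_pi]
  rw [hbox]
  exact h3

lemma setIntegral_box_proj {f : Torus n → ℂ} (hf : AEStronglyMeasurable f) :
    ∫ x in box n, f (proj x) = ∫ x, f x := by
  rw [← measurePreserving_proj.map_eq] at hf ⊢
  rw [integral_map continuous_proj.aemeasurable hf]

variable (n) in
/-- The volume `(2π)ⁿ` of the torus. -/
def vol : ℝ := (2 * Real.pi) ^ n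

variable (n) in
lemma vol_pos : 0 < vol n := by unfold vol; positivity

lemma volume_real_univ : (volume : Measure (Torus n)).real Set.univ = vol n := by
  simp [vol, measureReal_def, volume_pi, Measure.pi_univ, AddCircle.measure_univ,
    ENNReal.toReal_ofReal Real.pi_pos.le]

lemma integral_mode_of_ne_zero {k : Fin n → ℤ} (hk : k ≠ 0) : ∫ x, mode k x = 0 := by
  obtain ⟨i, hi⟩ : ∃ i, k i ≠ 0 := by
    by_contra! h; exact hk (funext h)
  have h : ∀ y : Torus n, mode k y * ∫ x, mode k x = ∫ x, mode k x := by
    intro y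
    rw [← integral_const_mul]
    calc ∫ x, mode k y * mode k x = ∫ x, mode k (x + y) := by
          simp only [mode_add_right, mul_comm]
      _ = ∫ x, mode k x := integral_add_right_eq_self (fun x => mode k x) y
  -- Translating by `π / k i` in the `i`-th coordinate multiplies the mode by `exp(iπ) = -1`, so its
  -- integral equals its own opposite.
  have h2 := h (proj (WithLp.toLp 2 (Pi.single i (Real.pi / k i))))
  rw [mode_proj] at h2
  have h3 : inner ℝ (emb k) (WithLp.toLp 2 (Pi.single i (Real.pi / k i)) : Euc n) = Real.pi := by
    rw [PiLp.inner_apply, Finset.sum_eq_single i]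
    · simp
      field_simp
    · intro j _ hj; simp [hj]
    · simp
  rw [h3, mul_comm Complex.I, Complex.exp_pi_mul_I] at h2
  linear_combination (-1 / 2 : ℂ) * h2

lemma integral_mode (k : Fin n → ℤ) : ∫ x, mode k x = if k = 0 then (vol n : ℂ) else 0 := by
  split_ifs with h
  · subst h
    simp [volume_real_univ]
  · exact integral_mode_of_ne_zero h

/-- Trigonometric polynomials are dense in the continuous functions. -/
theorem span_mode_closure_eq_top :
    (Submodule.span ℂ (Set.range (mode (n := n)))).topologicalClosure = ⊤ := by
  let A : StarSubalgebra ℂ C(Torus n, ℂ) :=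
    { toSubalgebra := Algebra.adjoin ℂ (Set.range mode)
      star_mem' := by
        change Algebra.adjoin ℂ (Set.range mode) ≤ star (Algebra.adjoin ℂ (Set.range mode))
        refine Algebra.adjoin_le ?_
        rintro _ ⟨k, rfl⟩
        refine Algebra.subset_adjoin ⟨-k, ?_⟩
        ext x
        simp only [mode_neg, starRingEnd_apply, ContinuousMap.star_apply] }
  have hA : A.toSubalgebra.toSubmodule = Submodule.span ℂ (Set.range mode) := by
    apply Algebra.adjoin_eq_span_of_subset
    refine .trans (fun x ↦ Submonoid.closure_induction (fun _ ↦ id) ⟨0, ?_⟩ ?_)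
      Submodule.subset_span
    · ext z; simp
    · rintro _ _ _ _ ⟨m, rfl⟩ ⟨l, rfl⟩
      exact ⟨m + l, by ext z; simp [mode_add]⟩
  have hsep : A.SeparatesPoints := by
    intro x y hxy
    obtain ⟨i, hi⟩ := Function.ne_iff.1 hxy
    refine ⟨_, ⟨mode (Pi.single i 1), Algebra.subset_adjoin ⟨Pi.single i 1, rfl⟩, rfl⟩, ?_⟩
    have key : ∀ z : Torus n, mode (Pi.single i 1) z = fourier 1 (z i) := by
      intro z
      rw [mode_apply, Finset.prod_eq_single i]
      · simp
      · intro j _ hj; simp [hj]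
      · simp
    simp only
    rw [key, key, fourier_one, fourier_one, Ne, Circle.coe_inj]
    contrapose hi
    exact AddCircle.injective_toCircle Real.two_pi_pos.ne' hi
  rw [← hA]
  exact congr_arg (Subalgebra.toSubmodule <| StarSubalgebra.toSubalgebra ·)
    (ContinuousMap.starSubalgebra_topologicalClosure_eq_top_of_separatesPoints A hsep)

/-- The trigonometric polynomial `∑_{k ∈ S} c_k e_k`. -/
def trigPoly (S : Finset (Fin n → ℤ)) (c : (Fin n → ℤ) → ℂ) : C(Torus n, ℂ) :=
  ∑ k ∈ S, c k • mode k

lemma trigPoly_apply (S : Finset (Fin n → ℤ)) (c : (Fin n → ℤ) → ℂ) (x : Torus n) :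
    trigPoly S c x = ∑ k ∈ S, c k * mode k x := by
  simp [trigPoly]

/-- Uniform approximation of continuous functions by trigonometric polynomials. -/
theorem exists_trigPoly_near (f : C(Torus n, ℂ)) {ε : ℝ} (hε : 0 < ε) :
    ∃ (S : Finset (Fin n → ℤ)) (c : (Fin n → ℤ) → ℂ), ∀ x, ‖f x - trigPoly S c x‖ ≤ ε := by
  have hf : f ∈ (Submodule.span ℂ (Set.range (mode (n := n)))).topologicalClosure := by
    rw [span_mode_closure_eq_top]; trivial
  obtain ⟨g, hg, hfg⟩ := Metric.mem_closure_iff.1 hf ε hε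
  obtain ⟨c, rfl⟩ := Finsupp.mem_span_range_iff_exists_finsupp.1 hg
  refine ⟨c.support, c, fun x => ?_⟩
  have := (ContinuousMap.norm_coe_le_norm (f - c.sum fun i a => a • mode i) x).trans
    ((dist_eq_norm f _).symm.le.trans hfg.le)
  simpa [trigPoly, Finsupp.sum] using this

/-- The mean square of the coefficients. -/
def coeffSq (S : Finset (Fin n → ℤ)) (c : (Fin n → ℤ) → ℂ) : ℝ := ∑ k ∈ S, ‖c k‖ ^ 2

lemma coeffSq_nonneg (S : Finset (Fin n → ℤ)) (c : (Fin n → ℤ) → ℂ) : 0 ≤ coeffSq S c :=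
  Finset.sum_nonneg fun _ _ => by positivity

lemma integrable_of_continuous {E : Type*} [NormedAddCommGroup E] {f : Torus n → E}
    (hf : Continuous f) : Integrable f :=
  hf.integrable_of_hasCompactSupport (HasCompactSupport.of_compactSpace f)

lemma ofReal_norm_sq (z : ℂ) : ((‖z‖ ^ 2 : ℝ) : ℂ) = conj z * z := by
  rw [mul_comm, Complex.mul_conj, Complex.normSq_eq_norm_sq]

/-- Expansion of the quadratic form attached to a multiplication operator. -/
lemma integral_mul_norm_sq_trigPoly {g : Torus n → ℂ} (hg : Continuous g)
    (S : Finset (Fin n → ℤ)) (c : (Fin n → ℤ) → ℂ) :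
    ∫ x, g x * ((‖trigPoly S c x‖ ^ 2 : ℝ) : ℂ) =
      ∑ k ∈ S, ∑ l ∈ S, conj (c k) * c l * ∫ x, mode (-(k - l)) x * g x := by
  simp_rw [← integral_const_mul]
  have hint : ∀ k l, Integrable fun x => conj (c k) * c l * (mode (-(k - l)) x * g x) := fun k l =>
    integrable_of_continuous (by fun_prop)
  have hsum : ∑ k ∈ S, ∑ l ∈ S, ∫ x, conj (c k) * c l * (mode (-(k - l)) x * g x) =
      ∫ x, ∑ k ∈ S, ∑ l ∈ S, conj (c k) * c l * (mode (-(k - l)) x * g x) := by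
    rw [integral_finsetSum _ fun k _ => integrable_finsetSum _ fun l _ => hint k l]
    exact Finset.sum_congr rfl fun k _ => (integral_finsetSum _ fun l _ => hint k l).symm
  rw [hsum]
  refine integral_congr_ae (Eventually.of_forall fun x => ?_)
  simp only
  rw [ofReal_norm_sq, trigPoly_apply, map_sum, Finset.sum_mul_sum, Finset.mul_sum]
  refine Finset.sum_congr rfl fun k _ => ?_
  rw [Finset.mul_sum]
  refine Finset.sum_congr rfl fun l _ => ?_
  rw [neg_sub, mode_sub, map_mul]
  ring

/-- Parseval's identity. -/
lemma integral_norm_sq_trigPoly (S : Finset (Fin n → ℤ)) (c : (Fin n → ℤ) → ℂ) :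
    ∫ x, ‖trigPoly S c x‖ ^ 2 = vol n * coeffSq S c := by
  have h := integral_mul_norm_sq_trigPoly (g := fun _ => 1) continuous_const S c
  simp only [one_mul, mul_one, integral_mode] at h
  apply Complex.ofReal_injective
  refine integral_ofReal.symm.trans (h.trans ?_)
  rw [coeffSq]
  push_cast
  rw [Finset.mul_sum]
  refine Finset.sum_congr rfl fun k hk => ?_
  rw [Finset.sum_eq_single k]
  · simp only [sub_self, neg_zero, if_true]
    have := ofReal_norm_sq (c k)
    push_cast at this
    rw [this]; ring
  · intro l _ hl
    rw [if_neg, mul_zero]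
    rw [neg_sub, sub_eq_zero]; exact hl
  · intro h; exact absurd hk h

end Modes

/-! ### Clusters of lattice points on spheres. -/

section Lattice

variable {n : ℕ}

/-- A finite set of lattice points is `M`-linked if it is nonempty and cannot be split into two
nonempty parts at distance greater than `M`. -/
def Linked (M : ℝ) (K : Finset (Fin n → ℤ)) : Prop :=
  K.Nonempty ∧ ∀ A ⊂ K, A.Nonempty → ∃ x ∈ A, ∃ y ∈ K, y ∉ A ∧ ‖emb (x - y)‖ ≤ M

lemma linked_singleton (M : ℝ) (x : Fin n → ℤ) : Linked M {x} := by
  refine ⟨by simp, fun A hA hne => ?_⟩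
  rw [Finset.ssubset_singleton_iff] at hA
  simp [hA] at hne

/-- A proper part of the enlarged set either contains `K`, and then misses `y` and is linked to it
through `x`; or meets `K` properly, and a link inside `K` serves; or is `{y}`, linked back to `x`.
-/
lemma Linked.insert {M : ℝ} {K : Finset (Fin n → ℤ)} (hK : Linked M K) {x y : Fin n → ℤ}
    (hx : x ∈ K) (hxy : ‖emb (x - y)‖ ≤ M) : Linked M (insert y K) := by
  classical
  refine ⟨by simp, fun A hA hne => ?_⟩
  by_cases hKA : K ⊆ A
  · refine ⟨x, hKA hx, y, by simp, fun hy => ?_, hxy⟩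
    exact hA.2 (Finset.insert_subset hy hKA)
  · by_cases hAK : (A ∩ K).Nonempty
    · have hss : A ∩ K ⊂ K :=
        ⟨Finset.inter_subset_right, fun h => hKA (h.trans Finset.inter_subset_left)⟩
      obtain ⟨u, hu, v, hv, hvA, huv⟩ := hK.2 _ hss hAK
      exact ⟨u, Finset.mem_of_mem_inter_left hu, v, Finset.mem_insert_of_mem hv,
        fun h => hvA (Finset.mem_inter.2 ⟨h, hv⟩), huv⟩
    · obtain ⟨a, ha⟩ := hne
      have hdisj : ∀ z ∈ A, z ∉ K := fun z hz hzK => hAK ⟨z, Finset.mem_inter.2 ⟨hz, hzK⟩⟩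
      have hay : a = y := (Finset.mem_insert.1 (hA.1 ha)).resolve_right (hdisj a ha)
      subst hay
      exact ⟨a, ha, x, Finset.mem_insert_of_mem hx, fun h => hdisj x h hx,
        by rwa [norm_emb_sub_comm]⟩

/-- A nonempty finite set is linked or splits into two separated smaller nonempty parts. -/
lemma linked_or_split (M : ℝ) {S : Finset (Fin n → ℤ)} (hS : S.Nonempty) :
    Linked M S ∨ ∃ A B : Finset (Fin n → ℤ), A ⊂ S ∧ B ⊂ S ∧ Disjoint A B ∧ A ∪ B = S ∧
      ∀ x ∈ A, ∀ y ∈ B, M < ‖emb (x - y)‖ := by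
  classical
  by_cases h : Linked M S
  · exact Or.inl h
  · right
    have h' : ¬ ∀ A ⊂ S, A.Nonempty → ∃ x ∈ A, ∃ y ∈ S, y ∉ A ∧ ‖emb (x - y)‖ ≤ M :=
      fun h' => h ⟨hS, h'⟩
    push Not at h'
    obtain ⟨A, hA, ⟨a, ha⟩, hsep⟩ := h'
    refine ⟨A, S \ A, hA, ⟨Finset.sdiff_subset, fun h => ?_⟩, Finset.disjoint_sdiff,
      Finset.union_sdiff_of_subset hA.1, fun x hx y hy => ?_⟩
    · exact (Finset.mem_sdiff.1 (h (hA.1 ha))).2 ha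
    · exact hsep x hx y (Finset.mem_sdiff.1 hy).1 (Finset.mem_sdiff.1 hy).2

/-- A sphere through the origin which contains given lattice points of norm at most `E` has
bounded intersection with their span. -/
lemma exists_bound_of_mem_span (n : ℕ) (E : ℝ) : ∃ B : ℝ, 0 ≤ B ∧
    ∀ T : Finset (Fin n → ℤ), (∀ v ∈ T, ‖emb v‖ ≤ E) →
    ∀ a : Euc n, (∀ v ∈ T, ‖emb v‖ ^ 2 = 2 * inner ℝ (emb v) a) →
    ∀ y ∈ Submodule.span ℝ (emb '' (T : Set (Fin n → ℤ))), ‖y‖ ^ 2 = 2 * inner ℝ y a → ‖y‖ ≤ B := by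
  classical
  have key : ∀ T : Finset (Fin n → ℤ), ∃ B : ℝ, 0 ≤ B ∧
      ∀ a : Euc n, (∀ v ∈ T, ‖emb v‖ ^ 2 = 2 * inner ℝ (emb v) a) →
      ∀ y ∈ Submodule.span ℝ (emb '' (T : Set (Fin n → ℤ))),
        ‖y‖ ^ 2 = 2 * inner ℝ y a → ‖y‖ ≤ B := by
    intro T
    by_cases h : ∃ a₀ : Euc n, ∀ v ∈ T, ‖emb v‖ ^ 2 = 2 * inner ℝ (emb v) a₀
    · obtain ⟨a₀, h₀⟩ := h
      -- The values on `T` determine the linear form `⟨·, a⟩` on the span of `T`. Hence `a` can be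
      -- replaced by one fixed solution `a₀`, and Cauchy-Schwarz gives `‖y‖ ≤ 2‖a₀‖` however large
      -- `a` is.
      refine ⟨2 * ‖a₀‖, by positivity, fun a ha y hy hya => ?_⟩
      have hspan : inner ℝ y a = inner ℝ y a₀ := by
        clear hya
        induction hy using Submodule.span_induction with
        | mem x hx =>
          obtain ⟨v, hv, rfl⟩ := hx
          have h1 := ha v hv
          have h2 := h₀ v hv
          linarith
        | zero => simp
        | add x z _ _ hx hz => rw [inner_add_left, inner_add_left, hx, hz]
        | smul t x _ hx => rw [inner_smul_left, inner_smul_left, hx]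
      have h1 := real_inner_le_norm y a₀
      rw [hspan] at hya
      by_contra hlt
      push Not at hlt
      nlinarith [norm_nonneg y, norm_nonneg a₀]
    · exact ⟨0, le_rfl, fun a ha => absurd ⟨a, ha⟩ h⟩
  choose B hB0 hB using key
  -- Only finitely many sets `T` fit in the ball of radius `E`; the sum of their bounds dominates
  -- each one.
  refine ⟨∑ T ∈ (latticeBall n E).powerset, B T, Finset.sum_nonneg fun T _ => hB0 T,
    fun T hT a ha y hy hya => (hB T a ha y hy hya).trans ?_⟩
  refine Finset.single_le_sum (f := B) (fun T _ => hB0 T) ?_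
  exact Finset.mem_powerset.2 fun v hv => mem_latticeBall.2 (hT v hv)

/-- The direction of the affine span of a set of lattice points. -/
def dirSpan (K : Finset (Fin n → ℤ)) : Submodule ℝ (Euc n) :=
  vectorSpan ℝ (emb '' (K : Set (Fin n → ℤ)))

lemma dirSpan_mono {K L : Finset (Fin n → ℤ)} (h : K ⊆ L) : dirSpan K ≤ dirSpan L :=
  vectorSpan_mono ℝ (Set.image_mono (by exact_mod_cast h))

lemma sub_mem_dirSpan {K : Finset (Fin n → ℤ)} {x y : Fin n → ℤ} (hx : x ∈ K) (hy : y ∈ K) :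
    emb x - emb y ∈ dirSpan K :=
  vsub_mem_vectorSpan ℝ (Set.mem_image_of_mem _ hx) (Set.mem_image_of_mem _ hy)

lemma dirSpan_eq_span {K : Finset (Fin n → ℤ)} {x : Fin n → ℤ} (hx : x ∈ K) :
    dirSpan K = Submodule.span ℝ (emb '' (K.image (· - x) : Finset (Fin n → ℤ))) := by
  rw [dirSpan, vectorSpan_eq_span_vsub_set_right ℝ (Set.mem_image_of_mem _ (Finset.mem_coe.2 hx))]
  congr 1
  ext y
  simp [emb_sub]

/-- The rank of a set of lattice points is the dimension of its affine span. -/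
def affRank (K : Finset (Fin n → ℤ)) : ℕ := Module.finrank ℝ (dirSpan K)

lemma affRank_mono {K L : Finset (Fin n → ℤ)} (h : K ⊆ L) : affRank K ≤ affRank L :=
  Submodule.finrank_mono (dirSpan_mono h)

lemma affRank_le (K : Finset (Fin n → ℤ)) : affRank K ≤ n := by
  simpa [affRank] using Submodule.finrank_le (dirSpan K)

/-- If a set of bounded diameter on a sphere spans the same affine space as a larger subset of
the sphere, then the larger set is in a ball of controlled radius. -/
lemma exists_bound_of_affRank_eq (n : ℕ) (E : ℝ) : ∃ B : ℝ, 0 ≤ B ∧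
    ∀ (r : ℝ) (K S : Finset (Fin n → ℤ)), K ⊆ S → (∀ k ∈ S, ‖emb k‖ = r) →
      (∀ x ∈ K, ∀ y ∈ K, ‖emb (x - y)‖ ≤ E) → affRank K = affRank S →
      ∀ x ∈ K, ∀ y ∈ S, ‖emb (y - x)‖ ≤ B := by
  classical
  obtain ⟨B, hB0, hB⟩ := exists_bound_of_mem_span n E
  refine ⟨B, hB0, fun r K S hKS hr hE hrank x hx y hy => ?_⟩
  -- With `x` as origin, the condition `‖z‖ = ‖x‖` becomes the equation of a sphere through the
  -- origin with centre `-x`.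
  have hq : ∀ z ∈ S, ‖emb (z - x)‖ ^ 2 = 2 * inner ℝ (emb (z - x)) (-emb x) := by
    intro z hz
    have h1 := hr z hz
    have h2 := hr x (hKS hx)
    rw [emb_sub, norm_sub_sq_real, inner_neg_right, inner_sub_left, real_inner_self_eq_norm_sq, h1,
      h2]
    ring
  refine hB (K.image (· - x)) ?_ (-emb x) ?_ (emb (y - x)) ?_ (hq y hy)
  · intro v hv
    obtain ⟨z, hz, rfl⟩ := Finset.mem_image.1 hv
    exact hE z hz x hx
  · intro v hv
    obtain ⟨z, hz, rfl⟩ := Finset.mem_image.1 hv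
    exact hq z (hKS hz)
  · rw [← dirSpan_eq_span hx, Submodule.eq_of_le_of_finrank_eq (dirSpan_mono hKS) hrank, emb_sub]
    exact sub_mem_dirSpan hy (hKS hx)

/-- Linked sets of lattice points on spheres have bounded diameter, uniformly in the radius. -/
lemma exists_diam_bound_of_affRank_le (n : ℕ) (M : ℝ) (hM : 0 ≤ M) (d : ℕ) : ∃ D : ℝ, 0 ≤ D ∧
    ∀ (r : ℝ) (K : Finset (Fin n → ℤ)), Linked M K → (∀ k ∈ K, ‖emb k‖ = r) → affRank K ≤ d →
      ∀ x ∈ K, ∀ y ∈ K, ‖emb (x - y)‖ ≤ D := by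
  classical
  induction d with
  | zero =>
    refine ⟨0, le_rfl, fun r K _ _ hd x hx y hy => ?_⟩
    have h0 : dirSpan K = ⊥ := Submodule.finrank_eq_zero.1 (Nat.le_zero.1 hd)
    have := sub_mem_dirSpan hx hy
    rw [h0, Submodule.mem_bot] at this
    rw [emb_sub, this, norm_zero]
  | succ d ih =>
    obtain ⟨D, hD0, hD⟩ := ih
    obtain ⟨B, hB0, hB⟩ := exists_bound_of_affRank_eq n (D + M)
    refine ⟨max D (B + B), le_max_of_le_left hD0, fun r K hK hr hd x hx y hy => ?_⟩
    rcases Nat.lt_or_ge d (affRank K) with hlt | hle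
    · have hrank : affRank K = d + 1 := le_antisymm hd hlt
      -- A maximal linked subset `L` of rank at most `d` has bounded diameter by induction. It is
      -- not all of `K`, so some `v` in `K` outside `L` is within `M` of it; by maximality, adding
      -- `v` raises the rank to that of `K`.
      let P := K.powerset.filter fun L => Linked M L ∧ affRank L ≤ d
      have hP : P.Nonempty := by
        refine ⟨{x}, ?_⟩
        simp only [P, Finset.mem_filter, Finset.mem_powerset, Finset.singleton_subset_iff]
        refine ⟨hx, linked_singleton M x, ?_⟩
        have : dirSpan ({x} : Finset (Fin n → ℤ)) = ⊥ := by simp [dirSpan]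
        rw [affRank, this, finrank_bot]
        exact Nat.zero_le d
      obtain ⟨L, hLP, hmax⟩ := P.exists_maximal hP
      simp only [P, Finset.mem_filter, Finset.mem_powerset] at hLP hmax
      obtain ⟨hLK, hL, hLd⟩ := hLP
      have hss : L ⊂ K := by
        refine ⟨hLK, fun h => ?_⟩
        have := affRank_mono h
        omega
      obtain ⟨u, hu, v, hv, hvL, huv⟩ := hK.2 L hss hL.1
      have hins : insert v L ⊆ K := Finset.insert_subset hv hLK
      have hlink := hL.insert hu huv
      have hrank' : affRank (insert v L) = affRank K := by
        refine le_antisymm (affRank_mono hins) ?_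
        by_contra hcon
        have := hmax ⟨hins, hlink, by omega⟩ (Finset.subset_insert v L)
        exact hvL (this (Finset.mem_insert_self v L))
      have hdL : ∀ a ∈ L, ∀ b ∈ L, ‖emb (a - b)‖ ≤ D :=
        hD r L hL (fun k hk => hr k (hLK hk)) hLd
      have hvL' : ∀ a ∈ L, ‖emb (a - v)‖ ≤ D + M := by
        intro a ha
        have : emb (a - v) = emb (a - u) + emb (u - v) := by simp only [emb_sub]; abel
        rw [this]
        exact (norm_add_le _ _).trans (add_le_add (hdL a ha u hu) huv)
      have hdiam : ∀ a ∈ insert v L, ∀ b ∈ insert v L, ‖emb (a - b)‖ ≤ D + M := by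
        intro a ha b hb
        rcases Finset.mem_insert.1 ha with ha' | ha' <;>
          rcases Finset.mem_insert.1 hb with hb' | hb'
        · rw [ha', hb', sub_self, emb_zero, norm_zero]; positivity
        · rw [ha', norm_emb_sub_comm]; exact hvL' b hb'
        · rw [hb']; exact hvL' a ha'
        · exact (hdL a ha' b hb').trans (by linarith)
      have hfin := hB r (insert v L) K hins hr hdiam hrank' v (Finset.mem_insert_self v L)
      have : emb (x - y) = emb (x - v) - emb (y - v) := by simp only [emb_sub]; abel
      rw [this]
      exact ((norm_sub_le _ _).trans (add_le_add (hfin x hx) (hfin y hy))).trans (le_max_right _ _)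
    · exact (hD r K hK hr hle x hx y hy).trans (le_max_left _ _)

lemma exists_diam_bound (n : ℕ) (M : ℝ) (hM : 0 ≤ M) : ∃ D : ℝ, 0 ≤ D ∧
    ∀ (r : ℝ) (K : Finset (Fin n → ℤ)), Linked M K → (∀ k ∈ K, ‖emb k‖ = r) →
      ∀ x ∈ K, ∀ y ∈ K, ‖emb (x - y)‖ ≤ D := by
  obtain ⟨D, hD0, hD⟩ := exists_diam_bound_of_affRank_le n M hM n
  exact ⟨D, hD0, fun r K hK hr => hD r K hK hr (affRank_le K)⟩

/-- The lattice points of a sphere fall into clusters of bounded diameter, at distance greater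
than `M` from each other; `κ` selects a point in each cluster. -/
lemma exists_cluster_label (n : ℕ) (M : ℝ) (hM : 0 ≤ M) : ∃ D : ℝ, 0 ≤ D ∧
    ∀ (r : ℝ) (S : Finset (Fin n → ℤ)), (∀ k ∈ S, ‖emb k‖ = r) →
      ∃ κ : (Fin n → ℤ) → (Fin n → ℤ), (∀ k ∈ S, κ k ∈ S ∧ ‖emb (k - κ k)‖ ≤ D) ∧
        ∀ k ∈ S, ∀ l ∈ S, ‖emb (k - l)‖ ≤ M → κ k = κ l := by
  classical
  obtain ⟨D, hD0, hD⟩ := exists_diam_bound n M hM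
  refine ⟨D, hD0, fun r S => ?_⟩
  induction S using Finset.strongInduction with
  | H S ih =>
    intro hr
    rcases S.eq_empty_or_nonempty with rfl | hne
    · exact ⟨id, by simp, by simp⟩
    -- A linked set gets a constant label. Otherwise the labels of the two separated parts are
    -- glued: no pair at distance at most `M` straddles them.
    rcases linked_or_split M hne with hlink | ⟨A, B, hA, hB, hdisj, hAB, hsep⟩
    · obtain ⟨x, hx⟩ := hne
      exact ⟨fun _ => x, fun k hk => ⟨hx, hD r S hlink hr k hk x hx⟩, fun _ _ _ _ _ => rfl⟩
    · obtain ⟨α, hα1, hα2⟩ := ih A hA fun k hk => hr k (hA.1 hk)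
      obtain ⟨β, hβ1, hβ2⟩ := ih B hB fun k hk => hr k (hB.1 hk)
      have hcase : ∀ k ∈ S, k ∈ A ∨ k ∈ B ∧ k ∉ A := by
        intro k hk
        rw [← hAB, Finset.mem_union] at hk
        by_cases h : k ∈ A
        · exact Or.inl h
        · exact Or.inr ⟨hk.resolve_left h, h⟩
      refine ⟨fun k => if k ∈ A then α k else β k, fun k hk => ?_, fun k hk l hl hkl => ?_⟩
      · rcases hcase k hk with h | ⟨h, h'⟩
        · simp only [h, if_true]
          exact ⟨hA.1 (hα1 k h).1, (hα1 k h).2⟩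
        · simp only [h', if_false]
          exact ⟨hB.1 (hβ1 k h).1, (hβ1 k h).2⟩
      · rcases hcase k hk with h | ⟨h, h'⟩ <;> rcases hcase l hl with g | ⟨g, g'⟩
        · simp only [h, g, if_true]; exact hα2 k h l g hkl
        · exact absurd hkl (not_le.2 (hsep k h l g))
        · rw [norm_emb_sub_comm] at hkl
          exact absurd hkl (not_le.2 (hsep l g k h))
        · simp only [h', g', if_false]; exact hβ2 k h l g hkl

end Lattice

/-! ### Uniform observability for frequencies on a sphere. -/

section Observability

variable {n : ℕ}

lemma analyticOnNhd_lift_trigPoly (S : Finset (Fin n → ℤ)) (c : (Fin n → ℤ) → ℂ) :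
    AnalyticOnNhd ℝ (lift (trigPoly S c)) Set.univ := by
  have h : lift (trigPoly S c) = fun x => ∑ k ∈ S, c k *
      Complex.exp ((Complex.I • Complex.ofRealCLM.comp (innerSL ℝ (emb k))) x) := by
    funext x
    simp [lift, trigPoly_apply, mode_proj]
  rw [h]
  intro x _
  refine Finset.analyticAt_fun_sum _ fun k _ => analyticAt_const.mul ?_
  have h1 : AnalyticAt ℝ Complex.exp
      ((Complex.I • Complex.ofRealCLM.comp (innerSL ℝ (emb k))) x) :=
    analyticAt_cexp.restrictScalars
  exact h1.comp (ContinuousLinearMap.analyticAt _ x)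

/-- A trigonometric polynomial which vanishes on a nonempty open set vanishes. -/
lemma trigPoly_eq_zero_of_isOpen {S : Finset (Fin n → ℤ)} {c : (Fin n → ℤ) → ℂ}
    {U : Set (Torus n)} (hU : IsOpen U) (hne : U.Nonempty) (h : ∀ x ∈ U, trigPoly S c x = 0)
    (x : Torus n) : trigPoly S c x = 0 := by
  obtain ⟨x₀, hx₀⟩ := hne
  have hev : lift (trigPoly S c) =ᶠ[𝓝 (rep x₀)] 0 := by
    have : proj ⁻¹' U ∈ 𝓝 (rep x₀) :=
      (hU.preimage continuous_proj).mem_nhds (by simpa using hx₀)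
    filter_upwards [this] with y hy
    exact h _ hy
  have := (analyticOnNhd_lift_trigPoly S c).eqOn_zero_of_preconnected_of_eventuallyEq_zero
    isPreconnected_univ (Set.mem_univ _) hev (Set.mem_univ (rep x))
  simpa [lift] using this

lemma trigPoly_smul (S : Finset (Fin n → ℤ)) (t : ℂ) (c : (Fin n → ℤ) → ℂ) (x : Torus n) :
    trigPoly S (fun k => t * c k) x = t * trigPoly S c x := by
  simp only [trigPoly_apply, Finset.mul_sum, mul_assoc]

lemma trigPoly_congr {S : Finset (Fin n → ℤ)} {b c : (Fin n → ℤ) → ℂ} (h : ∀ k ∈ S, b k = c k) :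
    trigPoly S b = trigPoly S c :=
  Finset.sum_congr rfl fun k hk => by rw [h k hk]

lemma coeffSq_eq_zero {S : Finset (Fin n → ℤ)} {c : (Fin n → ℤ) → ℂ}
    (h : ∀ x, trigPoly S c x = 0) : coeffSq S c = 0 := by
  have := integral_norm_sq_trigPoly S c
  simp only [h, norm_zero, ne_eq, OfNat.ofNat_ne_zero, not_false_eq_true, zero_pow,
    integral_zero] at this
  exact (mul_eq_zero.1 this.symm).resolve_left (vol_pos n).ne'

lemma ofReal_integral_mul_norm_sq (χ : C(Torus n, ℝ)) (S : Finset (Fin n → ℤ))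
    (c : (Fin n → ℤ) → ℂ) :
    ((∫ x, χ x * ‖trigPoly S c x‖ ^ 2 : ℝ) : ℂ) =
      ∫ x, (χ x : ℂ) * ((‖trigPoly S c x‖ ^ 2 : ℝ) : ℂ) := by
  refine integral_ofReal.symm.trans (integral_congr_ae (Eventually.of_forall fun x => ?_))
  simp

/-- If the integral were zero, the polynomial would vanish on the open set where `χ ≠ 0`, hence
everywhere by analyticity. -/
lemma integral_pos_of_coeffSq_ne_zero {χ : C(Torus n, ℝ)} (h0 : ∀ x, 0 ≤ χ x) (hχ : ∃ x, χ x ≠ 0)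
    {S : Finset (Fin n → ℤ)} {c : (Fin n → ℤ) → ℂ} (hc : coeffSq S c ≠ 0) :
    0 < ∫ x, χ x * ‖trigPoly S c x‖ ^ 2 := by
  have hcont : Continuous fun x => χ x * ‖trigPoly S c x‖ ^ 2 := by fun_prop
  have hnn : ∀ x, 0 ≤ χ x * ‖trigPoly S c x‖ ^ 2 := fun x => mul_nonneg (h0 x) (by positivity)
  refine lt_of_le_of_ne (integral_nonneg hnn) fun heq => hc ?_
  have hae := (integral_eq_zero_iff_of_nonneg hnn (integrable_of_continuous hcont)).1 heq.symm
  have hz : (fun x => χ x * ‖trigPoly S c x‖ ^ 2) = fun _ => 0 :=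
    (Continuous.ae_eq_iff_eq volume hcont continuous_const).1 hae
  refine coeffSq_eq_zero fun x => trigPoly_eq_zero_of_isOpen (U := {x | χ x ≠ 0})
    (isOpen_ne_fun χ.continuous continuous_const) hχ (fun y hy => ?_) x
  have := congrFun hz y
  simpa [show χ y ≠ 0 from hy] using this

/-- Observability for trigonometric polynomials with a fixed finite set of frequencies. -/
lemma exists_observability_fixed {χ : C(Torus n, ℝ)} (h0 : ∀ x, 0 ≤ χ x) (hχ : ∃ x, χ x ≠ 0)
    (S : Finset (Fin n → ℤ)) : ∃ C : ℝ, 0 < C ∧ ∀ c : (Fin n → ℤ) → ℂ,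
      C * coeffSq S c ≤ ∫ x, χ x * ‖trigPoly S c x‖ ^ 2 := by
  classical
  rcases S.eq_empty_or_nonempty with rfl | hne
  · exact ⟨1, one_pos, fun c => by simp [coeffSq, trigPoly_apply]⟩
  let ex : EuclideanSpace ℂ S → (Fin n → ℤ) → ℂ := fun v k => if h : k ∈ S then v ⟨k, h⟩ else 0
  have hex : ∀ k, Continuous fun v => ex v k := by
    intro k
    by_cases h : k ∈ S
    · simp only [ex, h, dif_pos]; exact PiLp.continuous_apply 2 _ _
    · simp only [ex, h, dif_neg, not_false_eq_true]; exact continuous_const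
  have hsq : ∀ v, coeffSq S (ex v) = ‖v‖ ^ 2 := by
    intro v
    rw [EuclideanSpace.norm_sq_eq, coeffSq, ← Finset.sum_coe_sort S]
    refine Finset.sum_congr rfl fun k _ => ?_
    simp [ex]
  have hcont : Continuous fun v => ∫ x, χ x * ‖trigPoly S (ex v) x‖ ^ 2 := by
    have : (fun v => ∫ x, χ x * ‖trigPoly S (ex v) x‖ ^ 2) = fun v => (∑ k ∈ S, ∑ l ∈ S,
        conj (ex v k) * ex v l * ∫ x, mode (-(k - l)) x * (χ x : ℂ)).re := by
      funext v
      rw [← integral_mul_norm_sq_trigPoly (by fun_prop), ← ofReal_integral_mul_norm_sq,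
        Complex.ofReal_re]
    rw [this]
    refine Complex.continuous_re.comp (continuous_finsetSum _ fun k _ =>
      continuous_finsetSum _ fun l _ => ?_)
    exact ((Complex.continuous_conj.comp (hex k)).mul (hex l)).mul continuous_const
  obtain ⟨s, hs⟩ := hne
  have : Nonempty S := ⟨⟨s, hs⟩⟩
  have hcomp : IsCompact (Metric.sphere (0 : EuclideanSpace ℂ S) 1) := isCompact_sphere _ _
  -- The constant is the minimum of the quadratic form on the unit sphere of coefficients, attained
  -- by compactness and positive by unique continuation.
  obtain ⟨v₀, hv₀, hmin⟩ := hcomp.exists_isMinOn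
    ⟨EuclideanSpace.single ⟨s, hs⟩ 1, by simp⟩ hcont.continuousOn
  have hv₀' : ‖v₀‖ = 1 := by simpa using hv₀
  refine ⟨_, integral_pos_of_coeffSq_ne_zero h0 hχ (c := ex v₀) (S := S)
    (by rw [hsq, hv₀']; simp), fun c => ?_⟩
  rcases eq_or_ne (coeffSq S c) 0 with hz | hz
  · rw [hz, mul_zero]
    exact integral_nonneg fun x => mul_nonneg (h0 x) (by positivity)
  let v : EuclideanSpace ℂ S := WithLp.toLp 2 fun k => c k
  have hexv : ∀ k ∈ S, ex v k = c k := fun k hk => by simp [ex, v, hk]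
  have hvc : coeffSq S c = ‖v‖ ^ 2 := by
    rw [← hsq]
    exact Finset.sum_congr rfl fun k hk => by rw [hexv k hk]
  have hv : ‖v‖ ≠ 0 := by
    intro h; rw [hvc, h] at hz; simp at hz
  have hmem : ((‖v‖⁻¹ : ℝ) : ℂ) • v ∈ Metric.sphere (0 : EuclideanSpace ℂ S) 1 := by
    rw [mem_sphere_zero_iff_norm, norm_smul]
    simp [hv]
  have hle := hmin hmem
  simp only [Set.mem_ofPred_eq] at hle
  have htrig : ∀ x, trigPoly S (ex (((‖v‖⁻¹ : ℝ) : ℂ) • v)) x =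
      ((‖v‖⁻¹ : ℝ) : ℂ) * trigPoly S c x := by
    intro x
    rw [← trigPoly_smul]
    refine DFunLike.congr_fun (trigPoly_congr fun k hk => ?_) x
    simp [ex, v, hk]
  have hint : ∫ x, χ x * ‖trigPoly S (ex (((‖v‖⁻¹ : ℝ) : ℂ) • v)) x‖ ^ 2 =
      (‖v‖ ^ 2)⁻¹ * ∫ x, χ x * ‖trigPoly S c x‖ ^ 2 := by
    rw [← integral_const_mul]
    refine integral_congr_ae (Eventually.of_forall fun x => ?_)
    simp only [htrig, norm_mul, mul_pow, Complex.norm_real, Real.norm_eq_abs, abs_inv, abs_norm,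
      inv_pow]
    ring
  rw [hint] at hle
  rw [hvc]
  have hpos : 0 < ‖v‖ ^ 2 := by positivity
  calc _ ≤ ((‖v‖ ^ 2)⁻¹ * ∫ x, χ x * ‖trigPoly S c x‖ ^ 2) * ‖v‖ ^ 2 :=
        mul_le_mul_of_nonneg_right hle hpos.le
    _ = _ := by field_simp

lemma sum_translate {E : Type*} [AddCommMonoid E] {S F : Finset (Fin n → ℤ)} {x : Fin n → ℤ}
    (hSF : ∀ y ∈ S, y - x ∈ F) {g : (Fin n → ℤ) → E} (hg : ∀ k, k ∉ S → g k = 0) :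
    ∑ m ∈ F, g (m + x) = ∑ k ∈ S, g k := by
  classical
  have h1 : ∑ m ∈ S.image (· - x), g (m + x) = ∑ k ∈ S, g k := by
    rw [Finset.sum_image fun a _ b _ hab => sub_left_injective hab]
    simp
  rw [← h1]
  symm
  refine Finset.sum_subset (fun m hm => ?_) fun m _ hm => hg _ fun hmS => hm ?_
  · obtain ⟨y, hy, rfl⟩ := Finset.mem_image.1 hm
    exact hSF y hy
  · exact Finset.mem_image.2 ⟨m + x, hmS, by simp⟩

/-- Translation of the frequencies of a trigonometric polynomial. -/
lemma exists_translate {S F : Finset (Fin n → ℤ)} {x : Fin n → ℤ} (hSF : ∀ y ∈ S, y - x ∈ F)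
    (c : (Fin n → ℤ) → ℂ) : ∃ b : (Fin n → ℤ) → ℂ, coeffSq F b = coeffSq S c ∧
      ∀ y, ‖trigPoly F b y‖ = ‖trigPoly S c y‖ := by
  classical
  refine ⟨fun m => if m + x ∈ S then c (m + x) else 0, ?_, fun y => ?_⟩
  · rw [coeffSq, sum_translate hSF (g := fun k => ‖if k ∈ S then c k else 0‖ ^ 2)
      (fun k hk => by simp [hk])]
    exact Finset.sum_congr rfl fun k hk => by simp [hk]
  -- The translated polynomial differs from the original by the unimodular factor `mode x`, so their
  -- moduli agree.
  · have : mode x y * trigPoly F (fun m => if m + x ∈ S then c (m + x) else 0) y =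
        trigPoly S c y := by
      rw [trigPoly_apply, Finset.mul_sum]
      have h := sum_translate hSF (g := fun k => (if k ∈ S then c k else 0) * mode k y)
        (fun k hk => by simp [hk])
      rw [trigPoly_apply]
      refine Eq.trans ?_ (h.trans (Finset.sum_congr rfl fun k hk => by simp [hk]))
      exact Finset.sum_congr rfl fun m _ => by rw [mode_add]; ring
    rw [← this, norm_mul, norm_mode, one_mul]

lemma integral_mode_neg_mul_trigPoly_eq_zero {F : Finset (Fin n → ℤ)} {b : (Fin n → ℤ) → ℂ}
    {j : Fin n → ℤ} (hj : j ∉ F) : ∫ x, mode (-j) x * trigPoly F b x = 0 := by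
  simp only [trigPoly_apply, Finset.mul_sum]
  rw [integral_finsetSum _ fun k _ => integrable_of_continuous (by fun_prop)]
  refine Finset.sum_eq_zero fun k hk => ?_
  have : ∀ x : Torus n, mode (-j) x * (b k * mode k x) = b k * mode (k - j) x := by
    intro x; rw [sub_eq_add_neg, mode_add]; ring
  simp only [this, integral_const_mul]
  rw [integral_mode_of_ne_zero, mul_zero]
  rw [sub_ne_zero]
  rintro rfl
  exact hj hk

/-- The quadratic form of a trigonometric polynomial of degree at most `M` is additive on sets of
frequencies at distance greater than `M`. -/
lemma integral_mul_norm_sq_union {F A B : Finset (Fin n → ℤ)} {M : ℝ}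
    (hF : ∀ m ∈ F, ‖emb m‖ ≤ M) (hsep : ∀ x ∈ A, ∀ y ∈ B, M < ‖emb (x - y)‖)
    [DecidableEq (Fin n → ℤ)] (hdisj : Disjoint A B) (b c : (Fin n → ℤ) → ℂ) :
    ∫ x, trigPoly F b x * ((‖trigPoly (A ∪ B) c x‖ ^ 2 : ℝ) : ℂ) =
      (∫ x, trigPoly F b x * ((‖trigPoly A c x‖ ^ 2 : ℝ) : ℂ)) +
        ∫ x, trigPoly F b x * ((‖trigPoly B c x‖ ^ 2 : ℝ) : ℂ) := by
  have hc : Continuous fun x => trigPoly F b x := by fun_prop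
  rw [integral_mul_norm_sq_trigPoly hc, integral_mul_norm_sq_trigPoly hc,
    integral_mul_norm_sq_trigPoly hc, Finset.sum_union hdisj]
  simp only [Finset.sum_union hdisj, Finset.sum_add_distrib]
  have h1 : ∑ k ∈ A, ∑ l ∈ B, conj (c k) * c l * ∫ x, mode (-(k - l)) x * trigPoly F b x = 0 := by
    refine Finset.sum_eq_zero fun k hk => Finset.sum_eq_zero fun l hl => ?_
    rw [integral_mode_neg_mul_trigPoly_eq_zero, mul_zero]
    exact fun h => absurd (hF _ h) (not_le.2 (hsep k hk l hl))
  have h2 : ∑ k ∈ B, ∑ l ∈ A, conj (c k) * c l * ∫ x, mode (-(k - l)) x * trigPoly F b x = 0 := by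
    refine Finset.sum_eq_zero fun k hk => Finset.sum_eq_zero fun l hl => ?_
    rw [integral_mode_neg_mul_trigPoly_eq_zero, mul_zero]
    intro h
    have := hF _ h
    rw [norm_emb_sub_comm] at this
    exact absurd this (not_le.2 (hsep l hl k hk))
  rw [h1, h2]
  ring

lemma re_integral_ge_of_near {χ : C(Torus n, ℝ)} {p : C(Torus n, ℂ)} {ε : ℝ}
    (hp : ∀ x, ‖(χ x : ℂ) - p x‖ ≤ ε) (S : Finset (Fin n → ℤ)) (c : (Fin n → ℤ) → ℂ) :
    |(∫ x, χ x * ‖trigPoly S c x‖ ^ 2) -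
      (∫ x, p x * ((‖trigPoly S c x‖ ^ 2 : ℝ) : ℂ)).re| ≤ ε * (vol n * coeffSq S c) := by
  have h1 : (∫ x, χ x * ‖trigPoly S c x‖ ^ 2) =
      (∫ x, (χ x : ℂ) * ((‖trigPoly S c x‖ ^ 2 : ℝ) : ℂ)).re := by
    rw [← ofReal_integral_mul_norm_sq, Complex.ofReal_re]
  rw [h1, ← Complex.sub_re, ← integral_sub (integrable_of_continuous (by fun_prop))
    (integrable_of_continuous (by fun_prop)), ← integral_norm_sq_trigPoly, ← integral_const_mul]
  refine (Complex.abs_re_le_norm _).trans (norm_integral_le_of_norm_le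
    (integrable_of_continuous (by fun_prop)) (Eventually.of_forall fun x => ?_))
  rw [← sub_mul, norm_mul, Complex.norm_real, norm_pow, norm_norm]
  exact mul_le_mul_of_nonneg_right (hp x) (by positivity)

/-- The strict inequality makes the case `d = 0` vacuous. The constant depends on `χ` and the rank
but not on the radius, which is what permits the approximation of `χ` to be fixed before `S` is
given. -/
lemma exists_observability_of_affRank_lt {χ : C(Torus n, ℝ)} (h0 : ∀ x, 0 ≤ χ x)
    (hχ : ∃ x, χ x ≠ 0) (d : ℕ) : ∃ C : ℝ, 0 < C ∧
      ∀ (r : ℝ) (S : Finset (Fin n → ℤ)), (∀ k ∈ S, ‖emb k‖ = r) → affRank S < d →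
        ∀ c : (Fin n → ℤ) → ℂ, C * coeffSq S c ≤ ∫ x, χ x * ‖trigPoly S c x‖ ^ 2 := by
  classical
  induction d with
  | zero => exact ⟨1, one_pos, fun r S _ h => absurd h (Nat.not_lt_zero _)⟩
  | succ d ih =>
    obtain ⟨C, hC, hobs⟩ := ih
    have hV := vol_pos n
    -- By Parseval, this precision costs `C / 4` times `coeffSq` each time `χ` is exchanged with its
    -- approximation.
    obtain ⟨F, b, hp⟩ := exists_trigPoly_near (n := n)
      ⟨fun x => (χ x : ℂ), by fun_prop⟩ (ε := C / (4 * vol n)) (by positivity)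
    simp only [ContinuousMap.coe_mk] at hp
    set M : ℝ := ∑ m ∈ F, ‖emb m‖ with hMdef
    have hM0 : 0 ≤ M := Finset.sum_nonneg fun _ _ => norm_nonneg _
    have hM : ∀ m ∈ F, ‖emb m‖ ≤ M := fun m hm =>
      Finset.single_le_sum (f := fun m : Fin n → ℤ => ‖emb m‖) (fun _ _ => norm_nonneg _) hm
    obtain ⟨D, hD0, hD⟩ := exists_diam_bound n M hM0
    obtain ⟨B, hB0, hB⟩ := exists_bound_of_affRank_eq n D
    obtain ⟨C', hC', hfix⟩ := exists_observability_fixed h0 hχ (latticeBall n B)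
    refine ⟨min (C / 2) C', by positivity, fun r S hr hd c => ?_⟩
    have hN := coeffSq_nonneg S c
    -- A linked subset of full rank confines all of `S` to a ball of radius `B`, and modulation
    -- reduces to the fixed frequency set `latticeBall n B`.
    by_cases hK : ∃ K ⊆ S, Linked M K ∧ affRank K = affRank S
    · obtain ⟨K, hKS, hlink, hrank⟩ := hK
      obtain ⟨x, hx⟩ := hlink.1
      have hdiam := hD r K hlink fun k hk => hr k (hKS hk)
      have hball := hB r K S hKS hr hdiam hrank x hx
      obtain ⟨b', hb1, hb2⟩ := exists_translate (F := latticeBall n B) (S := S) (x := x)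
        (fun y hy => mem_latticeBall.2 (hball y hy)) c
      have := hfix b'
      simp only [hb2, hb1] at this
      exact (mul_le_mul_of_nonneg_right (min_le_right _ _) hN).trans this
    · push Not at hK
      -- Otherwise every linked subset has rank below `d`. The approximating form is exactly
      -- additive over separated parts, so the constant `3C / 4` does not deteriorate with the
      -- number of pieces; returning to `χ` leaves `C / 2`.
      have hQ : ∀ T ⊆ S, C * (3 / 4) * coeffSq T c ≤
          (∫ x, trigPoly F b x * ((‖trigPoly T c x‖ ^ 2 : ℝ) : ℂ)).re := by
        intro T
        induction T using Finset.strongInduction with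
        | H T ihT =>
          intro hTS
          rcases T.eq_empty_or_nonempty with rfl | hne
          · simp [coeffSq, trigPoly_apply]
          rcases linked_or_split M hne with hlink | ⟨A, B, hA, hB, hdisj, hAB, hsep⟩
          · have hlt : affRank T < d := by
              have h1 := affRank_mono hTS
              have h2 := hK T hTS hlink
              omega
            have h1 := hobs r T (fun k hk => hr k (hTS hk)) hlt c
            have h2 := (abs_le.1 (re_integral_ge_of_near hp T c)).2
            have h3 : C / (4 * vol n) * (vol n * coeffSq T c) = C / 4 * coeffSq T c := by
              field_simp
            rw [h3] at h2
            linarith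
          · have h1 := ihT A hA (hA.1.trans hTS)
            have h2 := ihT B hB (hB.1.trans hTS)
            rw [← hAB, integral_mul_norm_sq_union hM hsep hdisj, Complex.add_re, coeffSq,
              Finset.sum_union hdisj, mul_add]
            exact add_le_add h1 h2
      have h1 := hQ S subset_rfl
      have h2 := (abs_le.1 (re_integral_ge_of_near hp S c)).1
      have h3 : C / (4 * vol n) * (vol n * coeffSq S c) = C / 4 * coeffSq S c := by
        field_simp
      rw [h3] at h2
      have h4 := mul_le_mul_of_nonneg_right (min_le_left (C / 2) C') hN
      linarith

/-- Observability: the mass of a trigonometric polynomial with frequencies on a sphere, seen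
through a continuous weight `χ ≥ 0`, is bounded below uniformly in the radius of the sphere. -/
theorem exists_observability {χ : C(Torus n, ℝ)} (h0 : ∀ x, 0 ≤ χ x) (hχ : ∃ x, χ x ≠ 0) :
    ∃ C : ℝ, 0 < C ∧ ∀ (r : ℝ) (S : Finset (Fin n → ℤ)), (∀ k ∈ S, ‖emb k‖ = r) →
      ∀ c : (Fin n → ℤ) → ℂ, C * coeffSq S c ≤ ∫ x, χ x * ‖trigPoly S c x‖ ^ 2 := by
  obtain ⟨C, hC, h⟩ := exists_observability_of_affRank_lt h0 hχ (n + 1)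
  exact ⟨C, hC, fun r S hr => h r S hr (Nat.lt_succ_of_le (affRank_le S))⟩

/-- A nonempty open subset of the torus carries a nonzero continuous weight. -/
lemma exists_weight {U : Set (Torus n)} (hU : IsOpen U) (hne : U.Nonempty) :
    ∃ χ : C(Torus n, ℝ), (∀ x, 0 ≤ χ x) ∧ (∀ x, χ x ≤ U.indicator 1 x) ∧ ∃ x, χ x ≠ 0 := by
  obtain ⟨x₀, hx₀⟩ := hne
  obtain ⟨χ, h1, h2, h3⟩ := exists_continuous_zero_one_of_isClosed hU.isClosed_compl
    (isClosed_singleton (x := x₀)) (by simpa using hx₀)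
  refine ⟨χ, fun x => (h3 x).1, fun x => ?_, x₀, ?_⟩
  · by_cases hx : x ∈ U
    · simpa [hx] using (h3 x).2
    · simpa [hx] using (h1 hx).le
  · rw [h2 rfl]; simp

end Observability

/-! ### Spectral support of eigenfunctions and the first assertion. -/

section Eigenfunctions

variable {n : ℕ}

/-- The (unnormalized) Fourier coefficient of a function on the torus. -/
def coeff (f : Torus n → ℂ) (m : Fin n → ℤ) : ℂ := ∫ x, mode (-m) x * f x

lemma continuous_of_lift {E : Type*} [TopologicalSpace E] {f : Torus n → E}
    (hf : Continuous fun x => f (proj x)) : Continuous f :=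
  (isOpenMap_proj.isQuotientMap continuous_proj proj_surjective).continuous_iff.2 hf

lemma exists_norm_le_of_continuous {f : Torus n → ℂ} (hf : Continuous f) :
    ∃ C, ∀ x, ‖f x‖ ≤ C := by
  obtain ⟨C, hC⟩ := isCompact_univ.exists_bound_of_continuousOn hf.continuousOn
  exact ⟨C, fun x => hC x trivial⟩

/-- Fourier coefficients of a directional derivative. -/
lemma coeff_of_hasDerivAt {f f' : Torus n → ℂ} {v : Euc n} (hf : Continuous f)
    (hf' : Continuous f')
    (h : ∀ x : Euc n, HasDerivAt (fun t : ℝ => lift f (x + t • v)) (lift f' x) 0)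
    (m : Fin n → ℤ) :
    coeff f' m = Complex.I * ((inner ℝ (emb m) v : ℝ) : ℂ) * coeff f m := by
  obtain ⟨C, hC⟩ := exists_norm_le_of_continuous hf'
  have hderiv : ∀ (x : Torus n) (t : ℝ),
      HasDerivAt (fun s : ℝ => f (x + proj (s • v))) (f' (x + proj (t • v))) t := by
    intro x t
    have h1 := h (rep x + t • v)
    have h2 : HasDerivAt (fun s : ℝ => s - t) 1 t := (hasDerivAt_id t).sub_const t
    have h3 := HasDerivAt.scomp_of_eq t h1 h2 (by simp)
    simp only [one_smul] at h3
    have e1 : lift f' (rep x + t • v) = f' (x + proj (t • v)) := by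
      simp [lift, proj_add]
    have e2 : (fun t_1 : ℝ => lift f (rep x + t • v + t_1 • v)) ∘ (fun s : ℝ => s - t) =
        fun s : ℝ => f (x + proj (s • v)) := by
      funext s
      have : rep x + t • v + (s - t) • v = rep x + s • v := by module
      simp only [Function.comp, this, lift, proj_add, proj_rep]
    rw [e1, e2] at h3
    exact h3
  -- The coefficient of the translate of `f` by `t • v` is differentiated at `t = 0` in two ways:
  -- under the integral, and through the exponential that translation invariance produces.
  have hG := (hasDerivAt_integral_of_dominated_loc_of_deriv_le (μ := (volume : Measure (Torus n)))
    (F := fun (t : ℝ) x => mode (-m) x * f (x + proj (t • v)))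
    (F' := fun (t : ℝ) x => mode (-m) x * f' (x + proj (t • v)))
    (x₀ := 0) (s := Set.univ) (bound := fun _ => C) univ_mem
    (Eventually.of_forall fun t => Continuous.aestronglyMeasurable (by fun_prop))
    (integrable_of_continuous (by fun_prop))
    (Continuous.aestronglyMeasurable (by fun_prop))
    (Eventually.of_forall fun x t _ => by simpa using hC _)
    (integrable_of_continuous continuous_const)
    (Eventually.of_forall fun x t _ => (hderiv x t).const_mul _)).2
  have hval : (fun t : ℝ => ∫ x, mode (-m) x * f (x + proj (t • v))) =
      fun t : ℝ => Complex.exp (t * (Complex.I * ((inner ℝ (emb m) v : ℝ) : ℂ))) * coeff f m := by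
    funext t
    rw [coeff, ← integral_const_mul,
      ← integral_add_right_eq_self (fun x => _ * (mode (-m) x * f x)) (proj (t • v))]
    refine integral_congr_ae (Eventually.of_forall fun x => ?_)
    have h1 : Complex.exp (t * (Complex.I * ((inner ℝ (emb m) v : ℝ) : ℂ))) =
        mode m (proj (t • v)) := by
      rw [mode_proj, inner_smul_right]
      push_cast
      ring_nf
    have h2 : mode m (proj (t • v)) * mode (-m) (proj (t • v)) = 1 := by
      rw [← mode_add]; simp
    simp only [h1, mode_add_right]
    linear_combination (-(mode (-m) x * f (x + proj (t • v)))) * h2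
  rw [hval] at hG
  have hE : HasDerivAt
      (fun t : ℝ => Complex.exp (t * (Complex.I * ((inner ℝ (emb m) v : ℝ) : ℂ))) * coeff f m)
      (Complex.I * ((inner ℝ (emb m) v : ℝ) : ℂ) * coeff f m) 0 := by
    have h1 : HasDerivAt (fun t : ℝ => (t : ℂ) * (Complex.I * ((inner ℝ (emb m) v : ℝ) : ℂ)))
        (1 * (Complex.I * ((inner ℝ (emb m) v : ℝ) : ℂ))) 0 :=
      (Complex.ofRealCLM.hasDerivAt (x := (0 : ℝ))).mul_const _
    have h2 := h1.cexp.mul_const (coeff f m)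
    simpa using h2
  have := hG.unique hE
  have h0 : proj (0 : Euc n) = 0 := by funext i; simp [proj]
  simpa [coeff, h0] using this

/-- The directional derivative of a function on the torus. -/
def torusDeriv (v : Euc n) (f : Torus n → ℂ) : Torus n → ℂ :=
  fun x => fderiv ℝ (lift f) (rep x) v

/-- The vector `rep (proj x) - x` is a period of `lift f`, so the derivative does not depend on the
representative. -/
lemma lift_torusDeriv (v : Euc n) (f : Torus n → ℂ) :
    lift (torusDeriv v f) = fun x => fderiv ℝ (lift f) x v := by
  funext x
  have h : (fun y => lift f (y + (rep (proj x) - x))) = lift f := by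
    funext y
    simp [lift, proj_add, proj_sub]
  have h2 := fderiv_comp_add_right (𝕜 := ℝ) (f := lift f) (x := x) (rep (proj x) - x)
  rw [h, add_sub_cancel] at h2
  simp only [lift, torusDeriv] at h2 ⊢
  rw [h2]

lemma contDiff_lift_torusDeriv (v : Euc n) {f : Torus n → ℂ} (hf : ContDiff ℝ ∞ (lift f)) :
    ContDiff ℝ ∞ (lift (torusDeriv v f)) := by
  rw [lift_torusDeriv]
  exact (hf.fderiv_right (m := ∞) (by simp)).clm_apply contDiff_const

lemma coeff_torusDeriv (v : Euc n) {f : Torus n → ℂ} (hf : ContDiff ℝ ∞ (lift f))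
    (m : Fin n → ℤ) :
    coeff (torusDeriv v f) m = Complex.I * ((inner ℝ (emb m) v : ℝ) : ℂ) * coeff f m := by
  refine coeff_of_hasDerivAt (continuous_of_lift hf.continuous)
    (continuous_of_lift (contDiff_lift_torusDeriv v hf).continuous) (fun x => ?_) m
  rw [lift_torusDeriv]
  have h1 : HasDerivAt (fun t : ℝ => x + t • v) v 0 := by
    simpa using ((hasDerivAt_id (0 : ℝ)).smul_const v).const_add x
  have h2 : HasFDerivAt (lift f) (fderiv ℝ (lift f) x) (x + (0 : ℝ) • v) := by
    simpa using (hf.differentiable (by simp) x).hasFDerivAt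
  exact h2.comp_hasDerivAt 0 h1

lemma coeff_trigPoly (S : Finset (Fin n → ℤ)) (c : (Fin n → ℤ) → ℂ) (m : Fin n → ℤ)
    [Decidable (m ∈ S)] :
    coeff (trigPoly S c) m = if m ∈ S then (vol n : ℂ) * c m else 0 := by
  split_ifs with hm
  · have h : ∀ x : Torus n, mode (-m) x * trigPoly S c x = ∑ k ∈ S, c k * mode (k - m) x := by
      intro x
      rw [trigPoly_apply, Finset.mul_sum]
      exact Finset.sum_congr rfl fun k _ => by rw [sub_eq_add_neg, mode_add]; ring
    simp only [coeff, h]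
    rw [integral_finsetSum _ fun k _ => integrable_of_continuous (by fun_prop)]
    simp only [integral_const_mul, integral_mode, sub_eq_zero]
    simp [hm, mul_comm]
  · exact integral_mode_neg_mul_trigPoly_eq_zero hm

/-- A continuous function is determined by its Fourier coefficients. -/
lemma eq_zero_of_coeff_eq_zero {g : Torus n → ℂ} (hg : Continuous g) (h : ∀ m, coeff g m = 0)
    (x : Torus n) : g x = 0 := by
  obtain ⟨C, hC⟩ := exists_norm_le_of_continuous hg
  have hC0 : 0 ≤ C := (norm_nonneg _).trans (hC x)
  have hV := vol_pos n
  have hle : ∀ ε : ℝ, 0 < ε → ∫ y, ‖g y‖ ^ 2 ≤ 0 + ε := by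
    intro ε hε
    -- Vanishing coefficients make `g` orthogonal to the approximation of `conj g`, so its squared
    -- norm is at most the approximation error. The `C + 1` keeps the denominator positive.
    obtain ⟨S, c, hp⟩ := exists_trigPoly_near ⟨fun y => conj (g y), by fun_prop⟩
      (ε := ε / ((C + 1) * vol n)) (by positivity)
    simp only [ContinuousMap.coe_mk] at hp
    have h1 : ∫ y, trigPoly S c y * g y = 0 := by
      simp only [trigPoly_apply, Finset.sum_mul]
      rw [integral_finsetSum _ fun k _ => integrable_of_continuous (by fun_prop)]
      refine Finset.sum_eq_zero fun k _ => ?_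
      have := h (-k)
      rw [coeff, neg_neg] at this
      simp only [mul_assoc, integral_const_mul, this, mul_zero]
    have h2 : ((∫ y, ‖g y‖ ^ 2 : ℝ) : ℂ) = ∫ y, (conj (g y) - trigPoly S c y) * g y := by
      simp only [sub_mul]
      rw [integral_sub (integrable_of_continuous (by fun_prop))
        (integrable_of_continuous (by fun_prop)), h1, sub_zero]
      refine integral_ofReal.symm.trans (integral_congr_ae (Eventually.of_forall fun y => ?_))
      exact ofReal_norm_sq (g y)
    have h3 : ∫ y, ‖g y‖ ^ 2 ≤ ‖∫ y, (conj (g y) - trigPoly S c y) * g y‖ := by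
      rw [← h2, Complex.norm_real]
      exact le_abs_self _
    refine h3.trans ?_
    have h4 := norm_integral_le_of_norm_le_const (μ := (volume : Measure (Torus n)))
      (C := ε / ((C + 1) * vol n) * C)
      (Eventually.of_forall fun y => ?_ : ∀ᵐ y ∂(volume : Measure (Torus n)),
        ‖(conj (g y) - trigPoly S c y) * g y‖ ≤ ε / ((C + 1) * vol n) * C)
    · rw [volume_real_univ] at h4
      refine h4.trans ?_
      rw [zero_add]
      calc ε / ((C + 1) * vol n) * C * vol n = ε * (C / (C + 1)) := by field_simp
        _ ≤ ε * 1 := mul_le_mul_of_nonneg_left ((div_le_one (by positivity)).2 (by linarith)) hε.le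
        _ = ε := mul_one ε
    · rw [norm_mul]
      exact mul_le_mul (hp y) (hC y) (norm_nonneg _) (by positivity)
  have hz : ∫ y, ‖g y‖ ^ 2 = 0 :=
    le_antisymm (le_of_forall_pos_le_add hle) (integral_nonneg fun y => by positivity)
  have hcont : Continuous fun y => ‖g y‖ ^ 2 := by fun_prop
  have hae := (integral_eq_zero_iff_of_nonneg (fun y => by positivity)
    (integrable_of_continuous hcont)).1 hz
  have h0 : (fun y => ‖g y‖ ^ 2) = fun _ => (0 : ℝ) :=
    (Continuous.ae_eq_iff_eq volume hcont continuous_const).1 hae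
  simpa using congrFun h0 x

/-- The spectrum of an eigenfunction lies on a sphere. -/
lemma IsNormalizedEigenfunction.coeff_eq_zero {lam : ℝ} (hlam : 0 ≤ lam) {ψ : Torus n → ℂ}
    (hψ : IsNormalizedEigenfunction lam ψ) {m : Fin n → ℤ} (hm : ‖emb m‖ ≠ lam) :
    coeff ψ m = 0 := by
  let e := EuclideanSpace.basisFun (Fin n) ℝ
  have hs := hψ.smooth
  have heq : ∀ x, -∑ i, torusDeriv (e i) (torusDeriv (e i) ψ) x = (lam : ℂ) ^ 2 * ψ x := by
    intro x
    have h1 := hψ.eigen (rep x)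
    rw [InnerProductSpace.laplacian_eq_iteratedFDeriv_orthonormalBasis _ e] at h1
    have h2 : lift ψ (rep x) = ψ x := by simp [lift]
    rw [h2] at h1
    rw [← h1]
    congr 1
    refine Finset.sum_congr rfl fun i _ => ?_
    have h3 : torusDeriv (e i) (torusDeriv (e i) ψ) x =
        fderiv ℝ (lift (torusDeriv (e i) ψ)) (rep x) (e i) := rfl
    rw [h3, lift_torusDeriv, iteratedFDeriv_two_apply, fderiv_clm_apply
      ((hs.fderiv_right (m := ∞) (by simp)).differentiable (by simp) _)
      (differentiableAt_const _)]
    simp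
  have h1 : ∀ i, coeff (torusDeriv (e i) (torusDeriv (e i) ψ)) m = -(m i : ℂ) ^ 2 * coeff ψ m := by
    intro i
    have hin : inner ℝ (emb m) (e i) = (m i : ℝ) := by
      simp [e, EuclideanSpace.inner_single_right]
    rw [coeff_torusDeriv _ (contDiff_lift_torusDeriv _ hs), coeff_torusDeriv _ hs, hin]
    push_cast
    linear_combination ((m i : ℂ) ^ 2 * coeff ψ m) * Complex.I_mul_I
  have hc : ∀ i, Continuous (torusDeriv (e i) (torusDeriv (e i) ψ)) := fun i =>
    continuous_of_lift
      (contDiff_lift_torusDeriv _ (contDiff_lift_torusDeriv _ hs)).continuous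
  have h2 : (lam : ℂ) ^ 2 * coeff ψ m = (∑ i, (m i : ℂ) ^ 2) * coeff ψ m := by
    calc (lam : ℂ) ^ 2 * coeff ψ m = ∫ x, mode (-m) x * ((lam : ℂ) ^ 2 * ψ x) := by
          rw [coeff, ← integral_const_mul]
          exact integral_congr_ae (Eventually.of_forall fun x => by ring)
      _ = ∫ x, -∑ i, mode (-m) x * torusDeriv (e i) (torusDeriv (e i) ψ) x := by
          simp only [← heq, Finset.mul_sum, mul_neg]
      _ = -∑ i, coeff (torusDeriv (e i) (torusDeriv (e i) ψ)) m := by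
          have hi : ∀ i ∈ Finset.univ, Integrable fun x : Torus n =>
              mode (-m) x * torusDeriv (e i) (torusDeriv (e i) ψ) x := fun i _ =>
            integrable_of_continuous ((mode (-m)).continuous.mul (hc i))
          rw [integral_neg, integral_finsetSum _ hi]
          rfl
      _ = _ := by
          simp only [h1, Finset.sum_mul, neg_mul, Finset.sum_neg_distrib, neg_neg]
  have h3 : ((‖emb m‖ ^ 2 : ℝ) : ℂ) = ∑ i, (m i : ℂ) ^ 2 := by
    rw [EuclideanSpace.norm_sq_eq]
    push_cast
    refine Finset.sum_congr rfl fun i _ => ?_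
    rw [emb_apply, ← Complex.ofReal_pow, Real.norm_eq_abs, sq_abs]
    simp
  rw [← h3] at h2
  by_contra hne
  have h4 := mul_right_cancel₀ hne h2
  have h5 : lam ^ 2 = ‖emb m‖ ^ 2 := by exact_mod_cast h4
  exact hm ((sq_eq_sq₀ (norm_nonneg _) hlam).1 h5.symm)

/-- An eigenfunction is a trigonometric polynomial with frequencies on a sphere. -/
theorem IsNormalizedEigenfunction.exists_trigPoly {lam : ℝ} (hlam : 0 ≤ lam) {ψ : Torus n → ℂ}
    (hψ : IsNormalizedEigenfunction lam ψ) :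
    ∃ (S : Finset (Fin n → ℤ)) (c : (Fin n → ℤ) → ℂ), (∀ k ∈ S, ‖emb k‖ = lam) ∧
      ψ = trigPoly S c ∧ vol n * coeffSq S c = 1 := by
  classical
  let S := (latticeBall n lam).filter fun k => ‖emb k‖ = lam
  let c : (Fin n → ℤ) → ℂ := fun k => (vol n : ℂ)⁻¹ * coeff ψ k
  have hcont : Continuous ψ := continuous_of_lift hψ.smooth.continuous
  have hV : (vol n : ℂ) ≠ 0 := by exact_mod_cast (vol_pos n).ne'
  have hmem : ∀ k, k ∈ S ↔ ‖emb k‖ = lam := by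
    intro k
    simp only [S, Finset.mem_filter, mem_latticeBall]
    exact ⟨fun h => h.2, fun h => ⟨h.le, h⟩⟩
  have heq : ψ = trigPoly S c := by
    funext x
    rw [← sub_eq_zero]
    refine eq_zero_of_coeff_eq_zero (g := fun x => ψ x - trigPoly S c x) (by fun_prop)
      (fun m => ?_) x
    have h1 : coeff (fun x => ψ x - trigPoly S c x) m = coeff ψ m - coeff (trigPoly S c) m := by
      simp only [coeff, mul_sub]
      exact integral_sub (integrable_of_continuous (by fun_prop))
        (integrable_of_continuous (by fun_prop))
    rw [h1, coeff_trigPoly]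
    split_ifs with hm
    · simp only [c]; field_simp; ring
    · rw [hψ.coeff_eq_zero hlam (fun h => hm ((hmem m).2 h)), sub_zero]
  refine ⟨S, c, fun k hk => (hmem k).1 hk, heq, ?_⟩
  rw [← integral_norm_sq_trigPoly, ← hψ.normalized, heq]

/-- Observability holds for a weight below the indicator of `U`; the normalization `vol n * coeffSq
S c = 1` turns its constant `C` into `C / vol n`. -/
theorem exists_lower_bound_of_isOpen {U : Set (Torus n)} (hU : IsOpen U) (hne : U.Nonempty) :
    ∃ c : ℝ, 0 < c ∧ ∀ lam : ℝ, 0 ≤ lam → ∀ ψ : Torus n → ℂ,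
      IsNormalizedEigenfunction lam ψ → c ≤ ∫ x in U, ‖ψ x‖ ^ 2 := by
  obtain ⟨χ, h0, h1, hχ⟩ := exists_weight hU hne
  obtain ⟨C, hC, hobs⟩ := exists_observability h0 hχ
  have hV := vol_pos n
  refine ⟨C / vol n, by positivity, fun lam hlam ψ hψ => ?_⟩
  obtain ⟨S, c, hS, rfl, hc⟩ := hψ.exists_trigPoly hlam
  have h2 := hobs lam S hS c
  have h3 : C * coeffSq S c = C / vol n := by
    rw [eq_div_iff hV.ne', mul_assoc, mul_comm (coeffSq S c), hc, mul_one]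
  rw [h3] at h2
  refine h2.trans ?_
  rw [← integral_indicator hU.measurableSet]
  refine integral_mono (integrable_of_continuous (by fun_prop))
    ((integrable_of_continuous (by fun_prop)).indicator hU.measurableSet) fun x => ?_
  by_cases hx : x ∈ U
  · have := h1 x
    simp only [hx, Set.indicator_of_mem, Pi.one_apply] at this ⊢
    exact mul_le_of_le_one_left (by positivity) this
  · have h4 := h1 x
    simp only [hx, Set.indicator_of_notMem, not_false_eq_true] at h4 ⊢
    exact mul_nonpos_of_nonpos_of_nonneg h4 (by positivity)

end Eigenfunctions

/-! ### Symbols and decay of their partial Fourier transforms. -/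

section Symbols

variable {n : ℕ}

lemma continuous_symbol {a : Cotangent n → ℂ} (ha : a ∈ TestFunctions n) : Continuous a := by
  have h : IsOpenMap (Prod.map (proj (n := n)) (id : Euc n → Euc n)) :=
    isOpenMap_proj.prodMap IsOpenMap.id
  refine (h.isQuotientMap (continuous_proj.prodMap continuous_id)
    (proj_surjective.prodMap Function.surjective_id)).continuous_iff.2 ?_
  exact ha.1.continuous

lemma exists_radius {a : Cotangent n → ℂ} (ha : HasCompactSupport a) :
    ∃ R : ℝ, ∀ x ξ, R < ‖ξ‖ → a (x, ξ) = 0 := by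
  obtain ⟨R, hR⟩ := (ha.image continuous_snd).isBounded.exists_norm_le
  refine ⟨R, fun x ξ hξ => ?_⟩
  by_contra hne
  exact absurd (hR ξ ⟨(x, ξ), subset_tsupport a hne, rfl⟩) (not_le.2 hξ)

lemma hasCompactSupport_of_radius {a : Cotangent n → ℂ} {R : ℝ}
    (h : ∀ x ξ, R < ‖ξ‖ → a (x, ξ) = 0) : HasCompactSupport a := by
  refine HasCompactSupport.intro (isCompact_univ.prod (isCompact_closedBall (0 : Euc n) R)) ?_
  rintro ⟨x, ξ⟩ hx
  refine h x ξ ?_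
  simpa using hx

lemma exists_norm_symbol_le {a : Cotangent n → ℂ} (ha : a ∈ TestFunctions n) :
    ∃ C : ℝ, 0 ≤ C ∧ ∀ z, ‖a z‖ ≤ C := by
  obtain ⟨C, hC⟩ := ha.2.exists_bound_of_continuous (continuous_symbol ha)
  exact ⟨C, (norm_nonneg _).trans (hC (0, 0)), hC⟩

/-- The directional derivative of a symbol. -/
def symDeriv (v : Euc n × Euc n) (a : Cotangent n → ℂ) : Cotangent n → ℂ :=
  fun z => fderiv ℝ (liftSymbol a) (rep z.1, z.2) v

lemma liftSymbol_symDeriv (v : Euc n × Euc n) (a : Cotangent n → ℂ) :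
    liftSymbol (symDeriv v a) = fun p => fderiv ℝ (liftSymbol a) p v := by
  funext p
  have h : (fun y => liftSymbol a (y + (rep (proj p.1) - p.1, 0))) = liftSymbol a := by
    funext y
    simp [liftSymbol, proj_add, proj_sub]
  have h2 := fderiv_comp_add_right (𝕜 := ℝ) (f := liftSymbol a) (x := p)
    (rep (proj p.1) - p.1, 0)
  have h3 : p + (rep (proj p.1) - p.1, 0) = (rep (proj p.1), p.2) := by
    ext1 <;> simp
  rw [h, h3] at h2
  rw [h2]
  rfl

lemma symDeriv_mem (v : Euc n × Euc n) {a : Cotangent n → ℂ} (ha : a ∈ TestFunctions n) :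
    symDeriv v a ∈ TestFunctions n := by
  obtain ⟨R, hR⟩ := exists_radius ha.2
  refine ⟨?_, hasCompactSupport_of_radius (R := R) fun x ξ hξ => ?_⟩
  · rw [liftSymbol_symDeriv]
    exact (ha.1.fderiv_right (m := ∞) (by simp)).clm_apply contDiff_const
  · have h : liftSymbol a =ᶠ[𝓝 (rep x, ξ)] fun _ => 0 := by
      have hopen : IsOpen {p : Euc n × Euc n | R < ‖p.2‖} :=
        isOpen_lt continuous_const (by fun_prop)
      filter_upwards [hopen.mem_nhds (show R < ‖ξ‖ from hξ)] with p hp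
      exact hR _ _ hp
    simp only [symDeriv]
    rw [h.fderiv_eq]
    simp

/-- The Fourier transform of a symbol in the momentum variable. -/
def momentumFourier (a : Cotangent n → ℂ) (x : Torus n) (w : Euc n) : ℂ :=
  ∫ ξ, a (x, ξ) * Complex.exp (Complex.I * ((inner ℝ w ξ : ℝ) : ℂ))

lemma norm_exp_I_mul (t : ℝ) : ‖Complex.exp (Complex.I * (t : ℂ))‖ = 1 := by
  rw [mul_comm, Complex.norm_exp_ofReal_mul_I]

lemma continuous_fibre {a : Cotangent n → ℂ} (ha : a ∈ TestFunctions n) (x : Torus n) :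
    Continuous fun ξ => a (x, ξ) :=
  (continuous_symbol ha).comp (by fun_prop)

lemma hasCompactSupport_fibre {a : Cotangent n → ℂ} (ha : a ∈ TestFunctions n) (x : Torus n) :
    HasCompactSupport fun ξ => a (x, ξ) := by
  obtain ⟨R, hR⟩ := exists_radius ha.2
  refine HasCompactSupport.intro (isCompact_closedBall (0 : Euc n) R) fun ξ hξ => hR x ξ ?_
  simpa using hξ

lemma continuous_momentumFourier {a : Cotangent n → ℂ} (ha : a ∈ TestFunctions n) :
    Continuous fun z : Torus n × Euc n => momentumFourier a z.1 z.2 := by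
  obtain ⟨R, hR⟩ := exists_radius ha.2
  have hc := continuous_symbol ha
  have h := continuous_parametric_integral_of_continuous (μ := (volume : Measure (Euc n)))
    (f := fun (z : Torus n × Euc n) ξ =>
      a (z.1, ξ) * Complex.exp (Complex.I * ((inner ℝ z.2 ξ : ℝ) : ℂ)))
    (by
      change Continuous fun p : (Torus n × Euc n) × Euc n =>
        a (p.1.1, p.2) * Complex.exp (Complex.I * ((inner ℝ p.1.2 p.2 : ℝ) : ℂ))
      fun_prop) (isCompact_closedBall (0 : Euc n) R)
  convert h using 2 with z
  symm
  refine setIntegral_eq_integral_of_forall_compl_eq_zero fun ξ hξ => ?_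
  rw [hR _ ξ (by simpa using hξ), zero_mul]

lemma exists_norm_momentumFourier_le {a : Cotangent n → ℂ} (ha : a ∈ TestFunctions n) :
    ∃ C : ℝ, ∀ x w, ‖momentumFourier a x w‖ ≤ C := by
  obtain ⟨R, hR⟩ := exists_radius ha.2
  obtain ⟨C, hC0, hC⟩ := exists_norm_symbol_le ha
  refine ⟨C * (volume : Measure (Euc n)).real (Metric.closedBall 0 R), fun x w => ?_⟩
  have h : momentumFourier a x w = ∫ ξ in Metric.closedBall (0 : Euc n) R,
      a (x, ξ) * Complex.exp (Complex.I * ((inner ℝ w ξ : ℝ) : ℂ)) := by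
    symm
    refine setIntegral_eq_integral_of_forall_compl_eq_zero fun ξ hξ => ?_
    rw [hR _ ξ (by simpa using hξ), zero_mul]
  rw [h]
  refine norm_setIntegral_le_of_norm_le_const
    (isCompact_closedBall (0 : Euc n) R).measure_lt_top fun ξ _ => ?_
  rw [norm_mul, norm_exp_I_mul, mul_one]
  exact hC _

/-- Integration by parts in the momentum; boundary terms are absent by compact support. -/
lemma momentumFourier_symDeriv {a : Cotangent n → ℂ} (ha : a ∈ TestFunctions n) (v : Euc n)
    (x : Torus n) (w : Euc n) :
    momentumFourier (symDeriv (0, v) a) x w =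
      -(Complex.I * ((inner ℝ w v : ℝ) : ℂ)) * momentumFourier a x w := by
  let f : Euc n → ℂ := fun ξ => Complex.exp (Complex.I * ((inner ℝ w ξ : ℝ) : ℂ))
  let g : Euc n → ℂ := fun ξ => a (x, ξ)
  have hfd : ∀ ξ, HasFDerivAt f
      (f ξ • (Complex.I • Complex.ofRealCLM.comp (innerSL ℝ w))) ξ := by
    intro ξ
    have := (Complex.I • Complex.ofRealCLM.comp (innerSL ℝ w)).hasFDerivAt (x := ξ)
    exact this.cexp
  have hf' : ∀ ξ, fderiv ℝ f ξ v = Complex.I * ((inner ℝ w v : ℝ) : ℂ) * f ξ := by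
    intro ξ
    rw [(hfd ξ).fderiv]
    simp [mul_comm]
  have hcurve : ∀ ξ, HasFDerivAt (fun η : Euc n => (rep x, η))
      (ContinuousLinearMap.inr ℝ (Euc n) (Euc n)) ξ := fun ξ => by
    exact hasFDerivAt_prodMk_right (rep x) ξ
  have hgd : ∀ ξ, HasFDerivAt g ((fderiv ℝ (liftSymbol a) (rep x, ξ)).comp
      (ContinuousLinearMap.inr ℝ (Euc n) (Euc n))) ξ := by
    intro ξ
    have h1 := (ha.1.differentiable (by simp) (rep x, ξ)).hasFDerivAt
    have h2 := h1.comp ξ (hcurve ξ)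
    have h3 : liftSymbol a ∘ (fun η : Euc n => (rep x, η)) = g := by
      funext η; simp [liftSymbol, g]
    rwa [h3] at h2
  have hg' : ∀ ξ, fderiv ℝ g ξ v = symDeriv (0, v) a (x, ξ) := by
    intro ξ
    rw [(hgd ξ).fderiv]
    simp [symDeriv]
  have hfc : Continuous f := by fun_prop
  have hgc : Continuous g := continuous_fibre ha x
  have hgs : HasCompactSupport g := hasCompactSupport_fibre ha x
  have hdc := continuous_fibre (symDeriv_mem (0, v) ha) x
  have hds := hasCompactSupport_fibre (symDeriv_mem (0, v) ha) x
  have key := integral_mul_fderiv_eq_neg_fderiv_mul_of_integrable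
    (μ := (volume : Measure (Euc n))) (f := f) (g := g) (v := v)
    (by
      simp only [hf']
      exact ((continuous_const.mul hfc).mul hgc).integrable_of_hasCompactSupport hgs.mul_left)
    (by
      simp only [hg']
      exact (hfc.mul hdc).integrable_of_hasCompactSupport hds.mul_left)
    ((hfc.mul hgc).integrable_of_hasCompactSupport hgs.mul_left)
    (fun ξ _ => (hfd ξ).differentiableAt) (fun ξ _ => (hgd ξ).differentiableAt)
  simp only [hf', hg'] at key
  simp only [momentumFourier]
  rw [neg_mul, ← integral_const_mul]
  refine Eq.trans ?_ (key.trans ?_)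
  · exact integral_congr_ae (Eventually.of_forall fun ξ => mul_comm _ _)
  · congr 1
    refine integral_congr_ae (Eventually.of_forall fun ξ => ?_)
    simp only [f, g]
    ring

lemma exists_coord_pow_mul_momentumFourier_le (N : ℕ) (i : Fin n) {a : Cotangent n → ℂ}
    (ha : a ∈ TestFunctions n) : ∃ C : ℝ, ∀ x w, |w i| ^ N * ‖momentumFourier a x w‖ ≤ C := by
  induction N generalizing a with
  | zero => simpa using exists_norm_momentumFourier_le ha
  | succ N ih =>
    obtain ⟨C, hC⟩ := ih (symDeriv_mem (0, EuclideanSpace.single i 1) ha)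
    refine ⟨C, fun x w => ?_⟩
    have := hC x w
    rw [momentumFourier_symDeriv ha, norm_mul, norm_neg, norm_mul, Complex.norm_I, one_mul,
      Complex.norm_real, EuclideanSpace.inner_single_right] at this
    simp only [one_mul, conj_trivial, Real.norm_eq_abs] at this
    rw [pow_succ, mul_assoc]
    exact this

/-- The exponent `n + 1` exceeds the dimension, which makes the bound integrable in `w`. It comes
from the bounds on `|w i| ^ (n + 1)` and convexity of the power. -/
lemma exists_momentumFourier_decay {a : Cotangent n → ℂ} (ha : a ∈ TestFunctions n) :
    ∃ C : ℝ, ∀ x w, ‖momentumFourier a x w‖ ≤ C * (1 + ‖w‖) ^ (-((n : ℝ) + 1)) := by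
  obtain ⟨C₀, hC₀⟩ := exists_norm_momentumFourier_le ha
  choose C hC using fun i => exists_coord_pow_mul_momentumFourier_le (n + 1) i ha
  refine ⟨2 ^ n * (C₀ + n ^ n * ∑ i, C i), fun x w => ?_⟩
  set A := ‖momentumFourier a x w‖
  have hA : 0 ≤ A := norm_nonneg _
  have h1 : (1 + ‖w‖) ^ (n + 1) ≤ 2 ^ n * (1 + ‖w‖ ^ (n + 1)) := by
    simpa using add_pow_le zero_le_one (norm_nonneg w) (n + 1)
  have h2 : ‖w‖ ≤ ∑ i, |w i| := by
    have hw : w = ∑ i, w i • EuclideanSpace.single i (1 : ℝ) := by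
      ext j; simp [Finset.sum_apply, Pi.single_apply]
    calc ‖w‖ = ‖∑ i, w i • EuclideanSpace.single i (1 : ℝ)‖ := by rw [← hw]
      _ ≤ ∑ i, ‖w i • EuclideanSpace.single i (1 : ℝ)‖ := norm_sum_le _ _
      _ = ∑ i, |w i| := by simp [norm_smul]
  have h3 : ‖w‖ ^ (n + 1) ≤ n ^ n * ∑ i, |w i| ^ (n + 1) := by
    refine (pow_le_pow_left₀ (norm_nonneg w) h2 _).trans ?_
    simpa using pow_sum_le_card_mul_sum_pow (s := Finset.univ) (f := fun i => |w i|)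
      (fun i _ => abs_nonneg _) n
  have h4 : (1 + ‖w‖) ^ (n + 1) * A ≤ 2 ^ n * (C₀ + n ^ n * ∑ i, C i) := by
    calc (1 + ‖w‖) ^ (n + 1) * A
        ≤ 2 ^ n * (1 + n ^ n * ∑ i, |w i| ^ (n + 1)) * A := by
          refine mul_le_mul_of_nonneg_right (h1.trans ?_) hA
          gcongr
      _ = 2 ^ n * (A + n ^ n * ∑ i, |w i| ^ (n + 1) * A) := by
          rw [← Finset.sum_mul]; ring
      _ ≤ _ := by
          gcongr with i
          · exact hC₀ x w
          · exact hC i x w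
  have hpos : 0 < (1 + ‖w‖) := by positivity
  rw [Real.rpow_neg hpos.le, ← div_eq_mul_inv, le_div_iff₀ (by positivity), mul_comm]
  exact_mod_cast h4

/-- The Fourier coefficient of a symbol in the position variable. -/
def symCoeff (a : Cotangent n → ℂ) (m : Fin n → ℤ) (ξ : Euc n) : ℂ := coeff (fun x => a (x, ξ)) m

lemma continuous_symCoeff {a : Cotangent n → ℂ} (ha : a ∈ TestFunctions n) (m : Fin n → ℤ) :
    Continuous (symCoeff a m) := by
  have hc := continuous_symbol ha
  have h := continuous_parametric_integral_of_continuous (μ := (volume : Measure (Torus n)))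
    (f := fun (ξ : Euc n) x => mode (-m) x * a (x, ξ))
    (by
      change Continuous fun p : Euc n × Torus n => mode (-m) p.2 * a (p.2, p.1)
      fun_prop) isCompact_univ
  simp only [setIntegral_univ] at h
  exact h

lemma hasCompactSupport_symCoeff {a : Cotangent n → ℂ} (ha : a ∈ TestFunctions n)
    (m : Fin n → ℤ) : HasCompactSupport (symCoeff a m) := by
  obtain ⟨R, hR⟩ := exists_radius ha.2
  refine HasCompactSupport.intro (isCompact_closedBall (0 : Euc n) R) fun ξ hξ => ?_
  have : ∀ x, a (x, ξ) = 0 := fun x => hR x ξ (by simpa using hξ)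
  simp [symCoeff, coeff, this]

lemma exists_norm_symCoeff_le {a : Cotangent n → ℂ} (ha : a ∈ TestFunctions n) :
    ∃ C : ℝ, 0 ≤ C ∧ ∀ m ξ, ‖symCoeff a m ξ‖ ≤ C := by
  obtain ⟨C, hC0, hC⟩ := exists_norm_symbol_le ha
  refine ⟨C * vol n, mul_nonneg hC0 (vol_pos n).le, fun m ξ => ?_⟩
  rw [← volume_real_univ]
  exact norm_integral_le_of_norm_le_const (Eventually.of_forall fun x => by simpa using hC _)

lemma symCoeff_symDeriv {a : Cotangent n → ℂ} (ha : a ∈ TestFunctions n) (v : Euc n)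
    (m : Fin n → ℤ) (ξ : Euc n) :
    symCoeff (symDeriv (v, 0) a) m ξ =
      Complex.I * ((inner ℝ (emb m) v : ℝ) : ℂ) * symCoeff a m ξ := by
  have hc := continuous_symbol ha
  have hc' := continuous_symbol (symDeriv_mem (v, 0) ha)
  refine coeff_of_hasDerivAt (by fun_prop) (by fun_prop) (fun x => ?_) m
  have h0 : lift (fun y => symDeriv (v, 0) a (y, ξ)) x =
      liftSymbol (symDeriv (v, 0) a) (x, ξ) := rfl
  rw [h0, liftSymbol_symDeriv]
  have h1 : HasDerivAt (fun t : ℝ => (x + t • v, ξ)) (v, 0) 0 := by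
    refine HasDerivAt.prodMk ?_ (hasDerivAt_const _ _)
    simpa using ((hasDerivAt_id (0 : ℝ)).smul_const v).const_add x
  have h2 : HasFDerivAt (liftSymbol a) (fderiv ℝ (liftSymbol a) (x, ξ)) (x + (0 : ℝ) • v, ξ) := by
    simpa using (ha.1.differentiable (by simp) (x, ξ)).hasFDerivAt
  exact h2.comp_hasDerivAt 0 h1

lemma exists_coord_pow_mul_symCoeff_le (N : ℕ) (i : Fin n) {a : Cotangent n → ℂ}
    (ha : a ∈ TestFunctions n) :
    ∃ C : ℝ, 0 ≤ C ∧ ∀ m ξ, |(m i : ℝ)| ^ N * ‖symCoeff a m ξ‖ ≤ C := by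
  induction N generalizing a with
  | zero => simpa using exists_norm_symCoeff_le ha
  | succ N ih =>
    obtain ⟨C, hC0, hC⟩ := ih (symDeriv_mem (EuclideanSpace.single i 1, 0) ha)
    refine ⟨C, hC0, fun m ξ => ?_⟩
    have := hC m ξ
    rw [symCoeff_symDeriv ha, norm_mul, norm_mul, Complex.norm_I, one_mul,
      Complex.norm_real, EuclideanSpace.inner_single_right] at this
    simp only [one_mul, conj_trivial, Real.norm_eq_abs, emb_apply] at this
    rw [pow_succ, mul_assoc]
    exact this

/-- The Fourier coefficients of a symbol on `T*𝕋²` are summable, uniformly in the momentum. -/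
lemma exists_summable_symCoeff {a : Cotangent 2 → ℂ} (ha : a ∈ TestFunctions 2) :
    ∃ s : (Fin 2 → ℤ) → ℝ, Summable s ∧ ∀ m ξ, ‖symCoeff a m ξ‖ ≤ s m := by
  classical
  obtain ⟨C₀, hC₀, h₀⟩ := exists_norm_symCoeff_le ha
  choose C hC0 hC using fun i => exists_coord_pow_mul_symCoeff_le 3 i ha
  -- The power `-3` is summable over a lattice of rank two. At `m = 0` it carries no information,
  -- hence the separate term `C₀`.
  refine ⟨fun m => (if m = 0 then C₀ else 0) + (∑ i, C i) * ‖m‖ ^ (-3 : ℝ),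
    (summable_of_ne_finset_zero (s := {0}) (by simp +contextual)).add
      ((EisensteinSeries.summable_one_div_norm_rpow (by norm_num)).mul_left _), fun m ξ => ?_⟩
  have hsum : 0 ≤ ∑ i, C i := Finset.sum_nonneg fun i _ => hC0 i
  rcases eq_or_ne m 0 with rfl | hm
  · simp only [if_true]
    exact (h₀ 0 ξ).trans (le_add_of_nonneg_right (by positivity))
  · simp only [hm, if_false, zero_add]
    have hpos : 0 < ‖m‖ := norm_pos_iff.2 hm
    obtain ⟨i, hi⟩ : ∃ i, ‖m‖ = ‖m i‖ := by
      obtain ⟨i, _, hi⟩ := Finset.exists_mem_eq_sup' Finset.univ_nonempty fun i => ‖m i‖₊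
      refine ⟨i, ?_⟩
      rw [Pi.norm_def, ← Finset.sup'_eq_sup Finset.univ_nonempty, hi]
      rfl
    have h1 := hC i m ξ
    rw [← Int.norm_eq_abs, ← hi] at h1
    have h2 : C i ≤ ∑ i, C i := Finset.single_le_sum (fun i _ => hC0 i) (Finset.mem_univ i)
    rw [Real.rpow_neg hpos.le, ← div_eq_mul_inv, le_div_iff₀ (by positivity), mul_comm]
    exact_mod_cast h1.trans h2

end Symbols

/-! ### The Wigner distribution in Fourier coordinates. -/

section Weyl

variable {n : ℕ}

open scoped FourierTransform

/-- Fourier inversion, with the kernel `exp(i⟨w,ξ⟩)`. -/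
lemma integral_exp_mul_fourier {f : Euc n → ℂ} (hf : Continuous f) (hfi : Integrable f)
    (hF : Integrable fun w => ∫ ξ, f ξ * Complex.exp (Complex.I * ((inner ℝ w ξ : ℝ) : ℂ)))
    (η : Euc n) :
    ∫ w, Complex.exp (-(Complex.I * ((inner ℝ w η : ℝ) : ℂ))) *
      ∫ ξ, f ξ * Complex.exp (Complex.I * ((inner ℝ w ξ : ℝ) : ℂ)) = vol n * f η := by
  set F : Euc n → ℂ := fun w => ∫ ξ, f ξ * Complex.exp (Complex.I * ((inner ℝ w ξ : ℝ) : ℂ))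
    with hFdef
  -- The rescaling by `2π` passes between the kernel `exp(i⟨w,ξ⟩)` and the normalization of `𝓕⁻`;
  -- its Jacobian is the factor `vol n`.
  have hinv : ∀ v : Euc n, 𝓕⁻ f v = F ((2 * Real.pi) • v) := by
    intro v
    rw [Real.fourierInv_eq', hFdef]
    refine integral_congr_ae (Eventually.of_forall fun ξ => ?_)
    simp only [smul_eq_mul, inner_smul_left, real_inner_comm v ξ]
    rw [mul_comm]
    congr 2
    simp
    ring
  have hpi : (2 * Real.pi) ≠ 0 := Real.two_pi_pos.ne'
  have hint : Integrable (𝓕 f) := by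
    have : 𝓕 f = fun v => F ((-(2 * Real.pi)) • v) := by
      funext v
      rw [neg_smul, ← smul_neg, ← hinv, Real.fourierInv_eq_fourier_neg, neg_neg]
    rw [this]
    exact hF.comp_smul (neg_ne_zero.2 hpi)
  have h1 := congrFun (hf.fourier_fourierInv_eq hfi hint) η
  rw [Real.fourier_eq'] at h1
  have h2 : ∫ v, Complex.exp (((-2 * Real.pi * inner ℝ v η : ℝ) : ℂ) * Complex.I) • 𝓕⁻ f v =
      ∫ v, (fun w => Complex.exp (-(Complex.I * ((inner ℝ w η : ℝ) : ℂ))) * F w)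
        ((2 * Real.pi) • v) := by
    refine integral_congr_ae (Eventually.of_forall fun v => ?_)
    simp only [hinv, smul_eq_mul, inner_smul_left]
    congr 2
    simp
    ring
  have h3 := Measure.integral_comp_smul volume
    (fun w => Complex.exp (-(Complex.I * ((inner ℝ w η : ℝ) : ℂ))) * F w) (2 * Real.pi)
  rw [h2, h3, finrank_euclideanSpace_fin, abs_of_pos (by positivity)] at h1
  rw [← h1, vol, Complex.real_smul, ← mul_assoc, ← Complex.ofReal_mul,
    mul_inv_cancel₀ (pow_ne_zero n hpi), Complex.ofReal_one, one_mul]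

/-- The Weyl quantization after the change of variables `y = x - hw`. -/
lemma weylOp_eq {h : ℝ} (hh : 0 < h) (a : Cotangent n → ℂ) (u : Torus n → ℂ) (x : Euc n) :
    weylOp h a (lift u) x = ((vol n)⁻¹ : ℝ) *
      ∫ w, momentumFourier a (proj x - proj ((h / 2) • w)) w * u (proj x - proj (h • w)) := by
  let G : Euc n → ℂ := fun y =>
    momentumFourier a (proj ((1 / 2 : ℝ) • (x + y))) (h⁻¹ • (x - y)) * lift u y
  have h1 : weylOp h a (lift u) x = (((2 * Real.pi * h) ^ n)⁻¹ : ℝ) * ∫ y, G y := by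
    simp only [weylOp, G, momentumFourier, inner_smul_left]
    congr 2
    funext y
    congr 2
    funext ξ
    congr 5
    simp [div_eq_inv_mul]
  have h2 : ∫ y, G y = (h ^ n : ℝ) * ∫ w, G (x - h • w) := by
    rw [← integral_sub_left_eq_self G volume x]
    have := Measure.integral_comp_smul volume (fun y => G (x - y)) h
    rw [this, finrank_euclideanSpace_fin, abs_of_pos (by positivity), Complex.real_smul, ← mul_assoc,
      ← Complex.ofReal_mul, mul_inv_cancel₀ (by positivity), Complex.ofReal_one, one_mul]
  have h3 : ∀ w, G (x - h • w) =
      momentumFourier a (proj x - proj ((h / 2) • w)) w * u (proj x - proj (h • w)) := by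
    intro w
    have e1 : (1 / 2 : ℝ) • (x + (x - h • w)) = x - (h / 2) • w := by module
    have e2 : h⁻¹ • (x - (x - h • w)) = w := by
      rw [sub_sub_cancel, smul_smul, inv_mul_cancel₀ hh.ne', one_smul]
    simp only [G, e1, e2, lift, proj_sub]
  rw [h1, h2, ← mul_assoc, ← Complex.ofReal_mul]
  simp only [h3]
  congr 2
  rw [vol, mul_pow]
  field_simp

lemma integrable_decay : Integrable fun w : Euc n => (1 + ‖w‖) ^ (-((n : ℝ) + 1)) :=
  integrable_one_add_norm (by simp)

lemma integrable_of_momentum_decay {Θ : Torus n × Euc n → ℂ} (hc : Continuous Θ) {C : ℝ}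
    (hC : ∀ z, ‖Θ z‖ ≤ C * (1 + ‖z.2‖) ^ (-((n : ℝ) + 1))) : Integrable Θ := by
  have h : Integrable (fun z : Torus n × Euc n => (1 : ℝ) * (C * (1 + ‖z.2‖) ^ (-((n : ℝ) + 1))))
      (volume.prod volume) :=
    (integrable_const (1 : ℝ)).mul_prod (integrable_decay.const_mul C)
  refine Integrable.mono' h hc.aestronglyMeasurable (Eventually.of_forall fun z => ?_)
  simpa using hC z

/-- The integrand of the Wigner distribution in the variables `(x, w)`. -/
def wignerIntegrand (h : ℝ) (a : Cotangent n → ℂ) (u v : Torus n → ℂ) (z : Torus n × Euc n) : ℂ :=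
  conj (u z.1) * (momentumFourier a (z.1 - proj ((h / 2) • z.2)) z.2 * v (z.1 - proj (h • z.2)))

lemma integrable_wignerIntegrand (h : ℝ) {a : Cotangent n → ℂ} (ha : a ∈ TestFunctions n)
    {u v : Torus n → ℂ} (hu : Continuous u) (hv : Continuous v) :
    Integrable (wignerIntegrand h a u v) := by
  have hc : Continuous (wignerIntegrand h a u v) := by
    have h1 := continuous_momentumFourier ha
    have h2 : Continuous fun z : Torus n × Euc n =>
        momentumFourier a (z.1 - proj ((h / 2) • z.2)) z.2 :=
      h1.comp (f := fun z : Torus n × Euc n => (z.1 - proj ((h / 2) • z.2), z.2)) (by fun_prop)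
    have h3 : Continuous fun z : Torus n × Euc n => v (z.1 - proj (h • z.2)) :=
      hv.comp (by fun_prop)
    exact (Complex.continuous_conj.comp (hu.comp continuous_fst)).mul (h2.mul h3)
  obtain ⟨C, hC⟩ := exists_momentumFourier_decay ha
  obtain ⟨Cu, hCu⟩ := exists_norm_le_of_continuous hu
  obtain ⟨Cv, hCv⟩ := exists_norm_le_of_continuous hv
  refine integrable_of_momentum_decay hc (C := Cu * (C * Cv)) fun z => ?_
  have h1 := hC (z.1 - proj ((h / 2) • z.2)) z.2
  have hCu0 : 0 ≤ Cu := (norm_nonneg _).trans (hCu 0)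
  have hCv0 : 0 ≤ Cv := (norm_nonneg _).trans (hCv 0)
  rw [wignerIntegrand, norm_mul, norm_mul, Complex.norm_conj]
  calc _ ≤ Cu * ((C * (1 + ‖z.2‖) ^ (-((n : ℝ) + 1))) * Cv) := by
        refine mul_le_mul (hCu _) (mul_le_mul h1 (hCv _) (norm_nonneg _) ?_) (by positivity) hCu0
        exact (norm_nonneg _).trans h1
    _ = _ := by ring

lemma wigner_eq {h : ℝ} (hh : 0 < h) {a : Cotangent n → ℂ} (ha : a ∈ TestFunctions n)
    {u : Torus n → ℂ} (hu : Continuous u) :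
    wigner h u a = ((vol n)⁻¹ : ℝ) * ∫ z, wignerIntegrand h a u u z := by
  have hint := integrable_wignerIntegrand h ha hu hu
  have h1 : ∀ x : Euc n, conj (lift u x) * weylOp h a (lift u) x =
      (fun X => ((vol n)⁻¹ : ℝ) * ∫ w, wignerIntegrand h a u u (X, w)) (proj x) := by
    intro x
    rw [weylOp_eq hh]
    simp only [wignerIntegrand, lift]
    rw [integral_const_mul]
    ring
  simp only [wigner, h1]
  have hint' : Integrable (fun X => ∫ w, wignerIntegrand h a u u (X, w)) :=
    Integrable.integral_prod_left hint
  rw [setIntegral_box_proj (hint'.aestronglyMeasurable.const_mul _), integral_const_mul]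
  congr 1
  exact (integral_prod _ hint).symm

lemma integral_mode_mul_momentumFourier {a : Cotangent n → ℂ} (ha : a ∈ TestFunctions n)
    (m : Fin n → ℤ) (w : Euc n) : ∫ x, mode (-m) x * momentumFourier a x w =
      ∫ ξ, symCoeff a m ξ * Complex.exp (Complex.I * ((inner ℝ w ξ : ℝ) : ℂ)) := by
  have hc := continuous_symbol ha
  have hint : Integrable (fun z : Torus n × Euc n => mode (-m) z.1 * (a z *
      Complex.exp (Complex.I * ((inner ℝ w z.2 : ℝ) : ℂ)))) (volume.prod volume) := by
    refine Continuous.integrable_of_hasCompactSupport (by fun_prop) ?_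
    exact (ha.2.mul_right (f' := fun z : Torus n × Euc n =>
      Complex.exp (Complex.I * ((inner ℝ w z.2 : ℝ) : ℂ)))).mul_left
  simp only [momentumFourier, symCoeff, coeff, ← integral_const_mul, ← integral_mul_const]
  rw [integral_integral_swap hint]
  simp only [mul_assoc]

/-- Shifting `x` by `(h / 2) • w` recentres the symbol. The position integral then selects the
coefficient `k - l`, and Fourier inversion in `w` evaluates it at the midpoint momentum. -/
lemma integral_wignerIntegrand_mode (h : ℝ) {a : Cotangent n → ℂ} (ha : a ∈ TestFunctions n)
    (k l : Fin n → ℤ) : ∫ z, wignerIntegrand h a (mode k) (mode l) z =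
      vol n * symCoeff a (k - l) ((h / 2) • (emb k + emb l)) := by
  have hint := integrable_wignerIntegrand h ha (mode k).continuous (mode l).continuous
  have h1 : ∀ w, ∫ x, wignerIntegrand h a (mode k) (mode l) (x, w) =
      Complex.exp (-(Complex.I * ((inner ℝ w ((h / 2) • (emb k + emb l)) : ℝ) : ℂ))) *
        ∫ ξ, symCoeff a (k - l) ξ * Complex.exp (Complex.I * ((inner ℝ w ξ : ℝ) : ℂ)) := by
    intro w
    rw [← integral_mode_mul_momentumFourier ha, ← integral_const_mul,
      ← integral_add_right_eq_self _ (proj ((h / 2) • w))]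
    refine integral_congr_ae (Eventually.of_forall fun x => ?_)
    have e1 : proj (h • w) = proj ((h / 2) • w) + proj ((h / 2) • w) := by
      rw [← proj_add]; congr 1; module
    have e2 : x + proj ((h / 2) • w) - proj (h • w) = x + proj (-((h / 2) • w)) := by
      have : proj (-((h / 2) • w)) = - proj ((h / 2) • w) := by funext i; simp [proj]
      rw [e1, this]; abel
    have e3 : x + proj ((h / 2) • w) - proj ((h / 2) • w) = x := by abel
    have e4 : mode (-k) (proj ((h / 2) • w)) * mode l (proj (-((h / 2) • w))) =
        Complex.exp (-(Complex.I * ((inner ℝ w ((h / 2) • (emb k + emb l)) : ℝ) : ℂ))) := by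
      rw [mode_proj, mode_proj, ← Complex.exp_add]
      congr 1
      have : emb (-k) = -emb k := by ext i; simp
      rw [this, inner_neg_left, inner_neg_right, inner_smul_right, inner_smul_right,
        inner_smul_right, inner_add_right, real_inner_comm w, real_inner_comm w]
      push_cast
      ring
    simp only [wignerIntegrand, e2, e3, mode_add_right, ← e4]
    rw [neg_sub, sub_eq_add_neg, mode_add, mode_neg, mode_neg, map_mul]
    ring
  have hswap : ∫ z, wignerIntegrand h a (mode k) (mode l) z =
      ∫ w, ∫ x, wignerIntegrand h a (mode k) (mode l) (x, w) := integral_prod_symm _ hint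
  rw [hswap]
  simp only [h1]
  refine integral_exp_mul_fourier (continuous_symCoeff ha _)
    ((continuous_symCoeff ha _).integrable_of_hasCompactSupport (hasCompactSupport_symCoeff ha _))
    ?_ _
  simp only [← integral_mode_mul_momentumFourier ha]
  obtain ⟨C, hC⟩ := exists_momentumFourier_decay ha
  have hcm := continuous_momentumFourier ha
  have : Integrable (fun z : Torus n × Euc n => mode (-(k - l)) z.1 * momentumFourier a z.1 z.2)
      (volume.prod volume) :=
    integrable_of_momentum_decay (by fun_prop) (C := C) fun z => by simpa using hC z.1 z.2
  exact this.integral_prod_right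

/-- The Wigner distribution of a trigonometric polynomial. -/
theorem wigner_trigPoly {h : ℝ} (hh : 0 < h) {a : Cotangent n → ℂ} (ha : a ∈ TestFunctions n)
    (S : Finset (Fin n → ℤ)) (c : (Fin n → ℤ) → ℂ) :
    wigner h (trigPoly S c) a = ∑ k ∈ S, ∑ l ∈ S,
      conj (c k) * c l * symCoeff a (k - l) ((h / 2) • (emb k + emb l)) := by
  rw [wigner_eq hh ha (trigPoly S c).continuous]
  have h1 : ∀ z, wignerIntegrand h a (trigPoly S c) (trigPoly S c) z = ∑ k ∈ S, ∑ l ∈ S,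
      conj (c k) * c l * wignerIntegrand h a (mode k) (mode l) z := by
    intro z
    simp only [wignerIntegrand, trigPoly_apply, map_sum, map_mul]
    rw [Finset.mul_sum, Finset.sum_mul_sum]
    refine Finset.sum_congr rfl fun k _ => Finset.sum_congr rfl fun l _ => ?_
    ring
  have hint : ∀ k l, Integrable fun z =>
      conj (c k) * c l * wignerIntegrand h a (mode k) (mode l) z := fun k l =>
    (integrable_wignerIntegrand h ha (mode k).continuous (mode l).continuous).const_mul _
  simp only [h1]
  rw [integral_finsetSum _ fun k _ => integrable_finsetSum _ fun l _ => hint k l, Finset.mul_sum]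
  refine Finset.sum_congr rfl fun k _ => ?_
  rw [integral_finsetSum _ fun l _ => hint k l, Finset.mul_sum]
  refine Finset.sum_congr rfl fun l _ => ?_
  rw [integral_const_mul, integral_wignerIntegrand_mode h ha]
  have hV : (vol n : ℂ) ≠ 0 := by exact_mod_cast (vol_pos n).ne'
  push_cast
  field_simp

end Weyl

/-! ### Cluster measures and semiclassical limits. -/

section Limits

variable {n : ℕ}

lemma sum_le_tsum_of_injective {ι κ : Type*} {β : κ → ℝ} (hβ : Summable β) (h0 : ∀ m, 0 ≤ β m)
    (S : Finset ι) {f : ι → κ} (hf : Function.Injective f) : ∑ l ∈ S, β (f l) ≤ ∑' m, β m := by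
  classical
  rw [← Finset.sum_image (s := S) (g := f) (f := β) fun a _ b _ h => hf h]
  exact hβ.sum_le_tsum _ fun m _ => h0 m

/-- Schur's bound for matrices dominated by a convolution kernel. -/
lemma norm_sum_conj_mul_le {β : (Fin n → ℤ) → ℝ} (hβ : Summable β) (h0 : ∀ m, 0 ≤ β m)
    (S : Finset (Fin n → ℤ)) (c : (Fin n → ℤ) → ℂ) {K : (Fin n → ℤ) → (Fin n → ℤ) → ℂ}
    (hK : ∀ k ∈ S, ∀ l ∈ S, ‖K k l‖ ≤ β (k - l)) :
    ‖∑ k ∈ S, ∑ l ∈ S, conj (c k) * c l * K k l‖ ≤ coeffSq S c * ∑' m, β m := by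
  have h1 : ‖∑ k ∈ S, ∑ l ∈ S, conj (c k) * c l * K k l‖ ≤
      ∑ k ∈ S, ∑ l ∈ S, (‖c k‖ ^ 2 / 2 * β (k - l) + ‖c l‖ ^ 2 / 2 * β (k - l)) := by
    refine (norm_sum_le _ _).trans (Finset.sum_le_sum fun k hk => (norm_sum_le _ _).trans
      (Finset.sum_le_sum fun l hl => ?_))
    rw [norm_mul, norm_mul, Complex.norm_conj]
    calc ‖c k‖ * ‖c l‖ * ‖K k l‖ ≤ ‖c k‖ * ‖c l‖ * β (k - l) :=
          mul_le_mul_of_nonneg_left (hK k hk l hl) (by positivity)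
      _ ≤ (‖c k‖ ^ 2 / 2 + ‖c l‖ ^ 2 / 2) * β (k - l) := by
          refine mul_le_mul_of_nonneg_right ?_ (h0 _)
          nlinarith [sq_nonneg (‖c k‖ - ‖c l‖)]
      _ = _ := add_mul _ _ _
  refine h1.trans ?_
  simp only [Finset.sum_add_distrib]
  have h2 : ∑ k ∈ S, ∑ l ∈ S, ‖c k‖ ^ 2 / 2 * β (k - l) ≤ coeffSq S c / 2 * ∑' m, β m := by
    rw [coeffSq, Finset.sum_div, Finset.sum_mul]
    refine Finset.sum_le_sum fun k _ => ?_
    rw [← Finset.mul_sum]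
    exact mul_le_mul_of_nonneg_left
      (sum_le_tsum_of_injective hβ h0 S (f := fun l => k - l) sub_right_injective) (by positivity)
  have h3 : ∑ k ∈ S, ∑ l ∈ S, ‖c l‖ ^ 2 / 2 * β (k - l) ≤ coeffSq S c / 2 * ∑' m, β m := by
    rw [Finset.sum_comm, coeffSq, Finset.sum_div, Finset.sum_mul]
    refine Finset.sum_le_sum fun l _ => ?_
    rw [← Finset.mul_sum]
    exact mul_le_mul_of_nonneg_left
      (sum_le_tsum_of_injective hβ h0 S (f := fun k => k - l) sub_left_injective) (by positivity)
  linarith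

/-- The unit cosphere bundle of the torus. -/
abbrev Cosphere (n : ℕ) : Type := Torus n × Metric.sphere (0 : Euc n) 1

/-- The inclusion of the unit cosphere bundle in the cotangent bundle. -/
def cosphereIncl (z : Cosphere n) : Cotangent n := (z.1, z.2.1)

@[fun_prop]
lemma continuous_cosphereIncl : Continuous (cosphereIncl (n := n)) := by
  unfold cosphereIncl
  fun_prop

/-- The part of a set of frequencies with a given label. -/
def labelled [DecidableEq (Fin n → ℤ)] (S : Finset (Fin n → ℤ)) (κ : (Fin n → ℤ) → (Fin n → ℤ))
    (p : Fin n → ℤ) : Finset (Fin n → ℤ) := S.filter fun k => κ k = p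

lemma sum_labelled [DecidableEq (Fin n → ℤ)] {E : Type*} [AddCommMonoid E]
    {S : Finset (Fin n → ℤ)} {κ : (Fin n → ℤ) → (Fin n → ℤ)} (hκ : ∀ k ∈ S, κ k ∈ S)
    (f : (Fin n → ℤ) → E) : ∑ p ∈ S, ∑ k ∈ labelled S κ p, f k = ∑ k ∈ S, f k :=
  Finset.sum_fiberwise_of_maps_to hκ f

lemma sum_coeffSq_labelled [DecidableEq (Fin n → ℤ)] {S : Finset (Fin n → ℤ)}
    {κ : (Fin n → ℤ) → (Fin n → ℤ)} (hκ : ∀ k ∈ S, κ k ∈ S) (c : (Fin n → ℤ) → ℂ) :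
    ∑ p ∈ S, coeffSq (labelled S κ p) c = coeffSq S c :=
  sum_labelled hκ _

/-- The sum over the clusters of the position densities, each placed at the momentum of the label
of the cluster, is a probability measure on the unit cosphere bundle. -/
lemma exists_clusterMeasure [DecidableEq (Fin n → ℤ)] {h : ℝ} (hh : 0 < h)
    {S : Finset (Fin n → ℤ)} (hS : ∀ k ∈ S, ‖emb k‖ = h⁻¹) {c : (Fin n → ℤ) → ℂ}
    (hc : vol n * coeffSq S c = 1) {κ : (Fin n → ℤ) → (Fin n → ℤ)} (hκ : ∀ k ∈ S, κ k ∈ S) :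
    ∃ m : ProbabilityMeasure (Cosphere n), ∀ g : Cotangent n → ℂ, Continuous g →
      ∫ z, g (cosphereIncl z) ∂(m : Measure (Cosphere n)) =
        ∑ p ∈ S, ∫ x, g (x, h • emb p) * ((‖trigPoly (labelled S κ p) c x‖ ^ 2 : ℝ) : ℂ) := by
  have hne : S.Nonempty := by
    rw [Finset.nonempty_iff_ne_empty]
    rintro rfl
    simp [coeffSq] at hc
  have hmem : ∀ k ∈ S, h • emb k ∈ Metric.sphere (0 : Euc n) 1 := by
    intro k hk
    rw [mem_sphere_zero_iff_norm, norm_smul, hS k hk, Real.norm_eq_abs, abs_of_pos hh,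
      mul_inv_cancel₀ hh.ne']
  obtain ⟨k₀, hk₀⟩ := hne
  -- The value outside `S` is arbitrary; only labels in `S` enter the sum.
  let dir : (Fin n → ℤ) → Metric.sphere (0 : Euc n) 1 := fun k =>
    if hk : k ∈ S then ⟨_, hmem k hk⟩ else ⟨_, hmem k₀ hk₀⟩
  have hdir : ∀ k ∈ S, (dir k : Euc n) = h • emb k := fun k hk => by simp [dir, hk]
  let ρ : (Fin n → ℤ) → Torus n → NNReal := fun p x => ‖trigPoly (labelled S κ p) c x‖₊ ^ 2
  have hρ : ∀ p, Continuous (ρ p) := fun p => by fun_prop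
  have hρ' : ∀ p x, ((ρ p x : NNReal) : ℝ) = ‖trigPoly (labelled S κ p) c x‖ ^ 2 := fun p x => by
    simp [ρ]
  let ν : (Fin n → ℤ) → Measure (Torus n) := fun p => volume.withDensity fun x => (ρ p x : ENNReal)
  have hν : ∀ p, IsFiniteMeasure (ν p) := by
    intro p
    refine isFiniteMeasure_withDensity (ne_of_lt ?_)
    have h1 := (integrable_of_continuous (f := fun x => ((ρ p x : NNReal) : ℝ))
      (by fun_prop)).hasFiniteIntegral
    simpa [HasFiniteIntegral] using h1
  let τ : (Fin n → ℤ) → Torus n → Cosphere n := fun p x => (x, dir p)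
  have hτ : ∀ p, Continuous (τ p) := fun p => by fun_prop
  let m : Measure (Cosphere n) := ∑ p ∈ S, (ν p).map (τ p)
  have hm : IsFiniteMeasure m := by
    have : ∀ p, IsFiniteMeasure ((ν p).map (τ p)) := fun p => inferInstance
    infer_instance
  have hint : ∀ g : Cotangent n → ℂ, Continuous g → ∫ z, g (cosphereIncl z) ∂m =
      ∑ p ∈ S, ∫ x, g (x, h • emb p) * ((‖trigPoly (labelled S κ p) c x‖ ^ 2 : ℝ) : ℂ) := by
    intro g hg
    have hgc : Continuous fun z : Cosphere n => g (cosphereIncl z) := by fun_prop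
    rw [integral_finsetSum_measure fun p _ => ?_]
    · refine Finset.sum_congr rfl fun p hp => ?_
      rw [integral_map (hτ p).aemeasurable hgc.aestronglyMeasurable,
        integral_withDensity_eq_integral_smul (hρ p).measurable]
      refine integral_congr_ae (Eventually.of_forall fun x => ?_)
      simp only [NNReal.smul_def, hρ', Complex.real_smul, τ, cosphereIncl, hdir p hp]
      ring
    · have : IsFiniteMeasure ((ν p).map (τ p)) := inferInstance
      exact hgc.integrable_of_hasCompactSupport (HasCompactSupport.of_compactSpace _)
  have hprob : IsProbabilityMeasure m := by
    have h1 := hint (fun _ => 1) continuous_const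
    simp only [one_mul] at h1
    have h2 : ∀ p, ∫ x, ((‖trigPoly (labelled S κ p) c x‖ ^ 2 : ℝ) : ℂ) =
        ((vol n * coeffSq (labelled S κ p) c : ℝ) : ℂ) := by
      intro p
      rw [← integral_norm_sq_trigPoly]
      exact integral_ofReal
    simp only [h2, integral_const, Complex.real_smul, mul_one] at h1
    rw [← Complex.ofReal_sum, ← Finset.mul_sum, sum_coeffSq_labelled hκ, hc] at h1
    have h3 : m.real Set.univ = 1 := by exact_mod_cast h1
    exact ⟨(ENNReal.toReal_eq_one_iff _).1 h3⟩
  exact ⟨⟨m, hprob⟩, hint⟩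

/-- Comparison of the Wigner distribution with the cluster measure. -/
lemma norm_wigner_sub_le [DecidableEq (Fin n → ℤ)] {h : ℝ} (hh : 0 < h) {a : Cotangent n → ℂ}
    (ha : a ∈ TestFunctions n) {s : (Fin n → ℤ) → ℝ} (hs : Summable s)
    (has : ∀ m ξ, ‖symCoeff a m ξ‖ ≤ s m) {S : Finset (Fin n → ℤ)} {c : (Fin n → ℤ) → ℂ}
    {κ : (Fin n → ℤ) → (Fin n → ℤ)} {D M : ℝ} (hκ : ∀ k ∈ S, κ k ∈ S ∧ ‖emb (k - κ k)‖ ≤ D)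
    (hκ' : ∀ k ∈ S, ∀ l ∈ S, ‖emb (k - l)‖ ≤ M → κ k = κ l)
    {F : Finset (Fin n → ℤ)} (hF : ∀ m ∈ F, ‖emb m‖ ≤ M) {δ : ℝ} (hδ0 : 0 ≤ δ)
    (hδ : ∀ m ∈ F, ∀ ξ ξ', ‖ξ - ξ'‖ ≤ h * D → ‖symCoeff a m ξ - symCoeff a m ξ'‖ ≤ δ) :
    ‖wigner h (trigPoly S c) a - ∑ p ∈ S, ∫ x, a (x, h • emb p) *
      ((‖trigPoly (labelled S κ p) c x‖ ^ 2 : ℝ) : ℂ)‖ ≤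
      coeffSq S c * (F.card * δ + 2 * ∑' m : {m // m ∉ F}, s m) := by
  have hs0 : ∀ m, 0 ≤ s m := fun m => (norm_nonneg _).trans (has m 0)
  have hac := continuous_symbol ha
  -- The matrix of the cluster measure: pairs in different clusters are dropped, and the momentum is
  -- moved from the midpoint to the label.
  let L : (Fin n → ℤ) → (Fin n → ℤ) → ℂ := fun k l =>
    if κ k = κ l then symCoeff a (k - l) (h • emb (κ k)) else 0
  have h1 : ∑ p ∈ S, ∫ x, a (x, h • emb p) * ((‖trigPoly (labelled S κ p) c x‖ ^ 2 : ℝ) : ℂ) =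
      ∑ k ∈ S, ∑ l ∈ S, conj (c k) * c l * L k l := by
    have e1 : ∀ p, ∫ x, a (x, h • emb p) * ((‖trigPoly (labelled S κ p) c x‖ ^ 2 : ℝ) : ℂ) =
        ∑ k ∈ labelled S κ p, ∑ l ∈ S, conj (c k) * c l * L k l := by
      intro p
      rw [integral_mul_norm_sq_trigPoly (g := fun x => a (x, h • emb p)) (by fun_prop)]
      refine Finset.sum_congr rfl fun k hk => ?_
      have hkp : κ k = p := (Finset.mem_filter.1 hk).2
      rw [labelled, Finset.sum_filter]
      refine Finset.sum_congr rfl fun l _ => ?_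
      simp only [L, hkp, eq_comm (a := p)]
      split_ifs
      · rfl
      · rw [mul_zero]
    simp only [e1]
    exact sum_labelled (fun k hk => (hκ k hk).1) _
  -- The difference of the two matrices is dominated by a convolution kernel: `δ` for differences in
  -- `F`, which are short and so join points of one cluster, and `2 * s` elsewhere, since each
  -- matrix is bounded by `s`.
  let β₁ : (Fin n → ℤ) → ℝ := fun m => if m ∈ F then δ else 0
  let β₂ : (Fin n → ℤ) → ℝ := Set.indicator {m | m ∉ F} fun m => 2 * s m
  have hβ₁ : HasSum β₁ (F.card * δ) := by
    have : ∑ m ∈ F, β₁ m = F.card * δ := by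
      rw [Finset.sum_congr rfl fun m hm => (if_pos hm : β₁ m = δ)]
      simp
    rw [← this]
    exact hasSum_sum_of_ne_finset_zero fun m hm => if_neg hm
  have hβ₂ : Summable β₂ := (hs.mul_left 2).indicator _
  have hβ₂' : ∑' m, β₂ m = 2 * ∑' m : {m // m ∉ F}, s m := by
    rw [← tsum_mul_left]
    exact (tsum_subtype {m | m ∉ F} fun m => 2 * s m).symm
  have hsum : Summable fun m => β₁ m + β₂ m := hβ₁.summable.add hβ₂
  rw [wigner_trigPoly hh ha, h1, ← hβ₂', ← hβ₁.tsum_eq, ← hβ₁.summable.tsum_add hβ₂,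
    ← Finset.sum_sub_distrib]
  simp only [← Finset.sum_sub_distrib, ← mul_sub]
  refine norm_sum_conj_mul_le hsum (fun m => ?_) S c fun k hk l hl => ?_
  · refine add_nonneg ?_ (Set.indicator_nonneg (fun m _ => by have := hs0 m; positivity) m)
    simp only [β₁]
    split_ifs
    · exact hδ0
    · exact le_rfl
  · by_cases hkl : k - l ∈ F
    · have hlab := hκ' k hk l hl (hF _ hkl)
      have hβ : β₁ (k - l) + β₂ (k - l) = δ := by simp [β₁, β₂, hkl]
      rw [hβ]
      simp only [L, hlab, if_true]
      refine hδ _ hkl _ _ ?_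
      -- Both points are within `D` of the common label, so the rescaled midpoint is within `h * D`
      -- of its momentum.
      have e : (h / 2) • (emb k + emb l) - h • emb (κ l) =
          (h / 2) • (emb (k - κ k) + emb (l - κ l)) := by
        rw [emb_sub, emb_sub, hlab]; module
      rw [e, norm_smul, Real.norm_eq_abs, abs_of_pos (by positivity)]
      have := (norm_add_le _ _).trans (add_le_add (hκ k hk).2 (hκ l hl).2)
      calc h / 2 * ‖emb (k - κ k) + emb (l - κ l)‖ ≤ h / 2 * (D + D) :=
            mul_le_mul_of_nonneg_left this (by positivity)
        _ = h * D := by ring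
    · have hβ : β₁ (k - l) + β₂ (k - l) = s (k - l) + s (k - l) := by
        simp [β₁, β₂, hkl, two_mul]
      rw [hβ]
      refine (norm_sub_le _ _).trans (add_le_add (has _ _) ?_)
      simp only [L]
      split_ifs
      · exact has _ _
      · simpa using hs0 _

/-- Along a sequence of eigenfunctions, there are probability measures on the unit cosphere bundle
which are asymptotic to the Wigner distributions along a subsequence, and whose masses in a given
open set are bounded below by the observability constant. -/
lemma exists_asymptotic_measures {h : ℕ → ℝ} {ψ : ℕ → Torus 2 → ℂ} (hh : ∀ j, 0 < h j)
    (hlim : Tendsto h atTop (𝓝 0)) (hψ : ∀ j, IsNormalizedEigenfunction (h j)⁻¹ (ψ j))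
    {χ : C(Torus 2, ℝ)} {C : ℝ} (hobs : ∀ (r : ℝ) (S : Finset (Fin 2 → ℤ)),
      (∀ k ∈ S, ‖emb k‖ = r) → ∀ c : (Fin 2 → ℤ) → ℂ,
        C * coeffSq S c ≤ ∫ x, χ x * ‖trigPoly S c x‖ ^ 2) :
    ∃ (j : ℕ → ℕ) (m : ℕ → ProbabilityMeasure (Cosphere 2)), Tendsto j atTop atTop ∧
      (∀ N, C / vol 2 ≤ ∫ z, χ z.1 ∂(m N : Measure (Cosphere 2))) ∧
      ∀ a ∈ TestFunctions 2, Tendsto (fun N => wigner (h (j N)) (ψ (j N)) a -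
        ∫ z, a (cosphereIncl z) ∂(m N : Measure (Cosphere 2))) atTop (𝓝 0) := by
  classical
  have hV := vol_pos 2
  choose S c hS hψS hc using fun j => (hψ j).exists_trigPoly (inv_pos.2 (hh j)).le
  choose D hD0 hD using fun N : ℕ => exists_cluster_label 2 (N : ℝ) (Nat.cast_nonneg N)
  -- The separation `N` fixes the diameter `D N`; the index is then taken so large that the rescaled
  -- clusters shrink to points.
  have hj : ∀ N : ℕ, ∃ j, N ≤ j ∧ h j * D N ≤ 1 / ((N : ℝ) + 1) := by
    intro N
    have h1 : Tendsto (fun j => h j * D N) atTop (𝓝 0) := by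
      simpa using hlim.mul_const (D N)
    have h2 := h1.eventually_le_const (show (0 : ℝ) < 1 / ((N : ℝ) + 1) by positivity)
    exact ((eventually_ge_atTop N).and h2).exists
  choose j hjN hjD using hj
  choose κ hκ hκ' using fun N => hD N _ _ (hS (j N))
  choose m hm using fun N => exists_clusterMeasure (hh (j N)) (hS (j N)) (hc (j N))
    fun k hk => (hκ N k hk).1
  have hcS : ∀ i, coeffSq (S i) (c i) = (vol 2)⁻¹ := fun i =>
    eq_inv_of_mul_eq_one_right (hc i)
  refine ⟨j, m, tendsto_atTop_mono hjN tendsto_id, fun N => ?_, fun a ha => ?_⟩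
  · have h1 := hm N (fun z => (χ z.1 : ℂ)) (by fun_prop)
    have h2 : ((∫ z, χ z.1 ∂(m N : Measure (Cosphere 2)) : ℝ) : ℂ) =
        ((∑ p ∈ S (j N), ∫ x, χ x *
          ‖trigPoly (labelled (S (j N)) (κ N) p) (c (j N)) x‖ ^ 2 : ℝ) : ℂ) := by
      rw [Complex.ofReal_sum]
      simp only [ofReal_integral_mul_norm_sq]
      exact integral_ofReal.symm.trans h1
    rw [Complex.ofReal_injective h2, div_eq_mul_inv, ← hcS (j N),
      ← sum_coeffSq_labelled (fun k hk => (hκ N k hk).1), Finset.mul_sum]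
    -- The frequencies of each cluster lie on the same sphere, so observability applies to each
    -- cluster with the same constant.
    exact Finset.sum_le_sum fun p _ => hobs _ _
      (fun k hk => hS (j N) k (Finset.mem_filter.1 hk).1) _
  · obtain ⟨s, hs, has⟩ := exists_summable_symCoeff ha
    rw [Metric.tendsto_atTop]
    intro ε hε
    -- The tail and the oscillation of the coefficients each contribute at most `ε / 4` after
    -- division by `vol 2`.
    obtain ⟨F, hF⟩ := ((tendsto_tsum_compl_atTop_zero s).eventually_lt_const
      (show (0 : ℝ) < ε * vol 2 / 8 by positivity)).exists
    set δ : ℝ := ε * vol 2 / (4 * (F.card + 1)) with hδ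
    have hδ0 : 0 < δ := by positivity
    have hunif : ∀ m ∈ F, ∀ᶠ N : ℕ in atTop, ∀ ξ ξ', ‖ξ - ξ'‖ ≤ h (j N) * D N →
        ‖symCoeff a m ξ - symCoeff a m ξ'‖ ≤ δ := by
      intro m _
      obtain ⟨η, hη, hu⟩ := Metric.uniformContinuous_iff.1
        ((hasCompactSupport_symCoeff ha m).uniformContinuous_of_continuous
          (continuous_symCoeff ha m)) δ hδ0
      filter_upwards [tendsto_one_div_add_atTop_nhds_zero_nat.eventually_lt_const hη] with N hN
      intro ξ ξ' hξ
      have : dist ξ ξ' < η := by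
        rw [dist_eq_norm]; exact (hξ.trans (hjD N)).trans_lt hN
      rw [← dist_eq_norm]
      exact (hu this).le
    have hev := ((Finset.eventually_all F).2 hunif).and
      ((Finset.eventually_all F).2 fun m _ =>
        tendsto_natCast_atTop_atTop.eventually_ge_atTop ‖emb m‖)
    obtain ⟨N₀, hN₀⟩ := eventually_atTop.1 hev
    refine ⟨N₀, fun N hN => ?_⟩
    obtain ⟨h1, h2⟩ := hN₀ N hN
    rw [dist_zero_right, hψS (j N), hm N a (continuous_symbol ha)]
    refine (norm_wigner_sub_le (hh (j N)) ha hs has (hκ N) (hκ' N) h2 hδ0.le h1).trans_lt ?_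
    rw [hcS]
    have h3 : (F.card : ℝ) * δ ≤ ε * vol 2 / 4 := by
      rw [hδ, mul_div_assoc', div_le_div_iff₀ (by positivity) (by positivity)]
      nlinarith [mul_pos hε hV]
    calc (vol 2)⁻¹ * (F.card * δ + 2 * ∑' m : {m // m ∉ F}, s m)
        ≤ (vol 2)⁻¹ * (ε * vol 2 / 4 + 2 * (ε * vol 2 / 8)) := by gcongr
      _ = ε / 2 := by field_simp; ring
      _ < ε := half_lt_self hε

/-- Semiclassical measures of the flat two-torus charge every nonempty open set. -/
theorem exists_represents_of_mem_semiclassicalMeasures {U : Set (Torus 2)} (hU : IsOpen U)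
    (hne : U.Nonempty) : ∃ c : ℝ, 0 < c ∧ ∀ μ ∈ semiclassicalMeasures 2,
      ∃ m : Measure (Cotangent 2), Represents m μ ∧
        ENNReal.ofReal c ≤ m (U ×ˢ Metric.sphere (0 : Euc 2) 1) := by
  obtain ⟨χ, h0, h1, hχ⟩ := exists_weight hU hne
  obtain ⟨C, hC, hobs⟩ := exists_observability h0 hχ
  have hV := vol_pos 2
  refine ⟨C / vol 2, by positivity, ?_⟩
  rintro μ ⟨-, h, ψ, hh, hlim, hψ, hμ⟩
  obtain ⟨j, m, hj, hmass, hasymp⟩ := exists_asymptotic_measures hh hlim hψ hobs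
  -- Weak compactness of the probability measures on the compact cosphere bundle gives a cluster
  -- point. Convergence along an ultrafilter finer than `atTop` serves as the subsequence, and the
  -- Wigner limits persist along it.
  obtain ⟨m', hm'⟩ := exists_clusterPt_of_compactSpace (map m atTop)
  obtain ⟨V, hVle, hVm⟩ := mapClusterPt_iff_ultrafilter.1 hm'
  have hprob : IsProbabilityMeasure (m' : Measure (Cosphere 2)) := inferInstance
  have hmeas : Measurable (cosphereIncl (n := 2)) := continuous_cosphereIncl.measurable
  refine ⟨(m' : Measure (Cosphere 2)).map cosphereIncl, ⟨?_, ?_, fun a => ?_⟩, ?_⟩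
  · exact Measure.isProbabilityMeasure_map hmeas.aemeasurable
  · rw [Measure.map_apply hmeas
      (MeasurableSet.univ.prod Metric.isClosed_sphere.measurableSet).compl]
    convert measure_empty (μ := (m' : Measure (Cosphere 2)))
    ext z
    simp [cosphereIncl]
  · have hac := continuous_symbol a.2
    rw [integral_map hmeas.aemeasurable hac.aestronglyMeasurable]
    have h2 := (ProbabilityMeasure.tendsto_iff_forall_integral_rclike_tendsto ℂ).1 hVm
      (BoundedContinuousFunction.mkOfCompact
        ⟨fun z => (a : Cotangent 2 → ℂ) (cosphereIncl z), by fun_prop⟩)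
    have h3 := ((hμ a).comp hj).mono_left hVle
    have h4 := h3.sub ((hasymp a a.2).mono_left hVle)
    simp only [Function.comp, sub_sub_cancel, sub_zero] at h4
    exact tendsto_nhds_unique h4 h2
  · have h2 := (ProbabilityMeasure.tendsto_iff_forall_integral_rclike_tendsto ℝ).1 hVm
      (BoundedContinuousFunction.mkOfCompact ⟨fun z => χ z.1, by fun_prop⟩)
    -- The lower bound passes to the weak limit because `χ` is continuous; the indicator of `U`
    -- enters only afterwards.
    have h3 : C / vol 2 ≤ ∫ z, χ z.1 ∂(m' : Measure (Cosphere 2)) :=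
      ge_of_tendsto h2 (Eventually.of_forall hmass)
    have hUm : MeasurableSet (Prod.fst ⁻¹' U : Set (Cosphere 2)) :=
      (hU.preimage continuous_fst).measurableSet
    have h4 : ∫ z, χ z.1 ∂(m' : Measure (Cosphere 2)) ≤
        (m' : Measure (Cosphere 2)).real (Prod.fst ⁻¹' U) := by
      rw [← integral_indicator_one hUm]
      refine integral_mono ?_ ((integrable_const (1 : ℝ)).indicator hUm) fun z => h1 z.1
      exact Continuous.integrable_of_hasCompactSupport (by fun_prop)
        (HasCompactSupport.of_compactSpace _)
    rw [Measure.map_apply hmeas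
      (hU.measurableSet.prod Metric.isClosed_sphere.measurableSet)]
    have h5 : cosphereIncl ⁻¹' (U ×ˢ Metric.sphere (0 : Euc 2) 1) =
        (Prod.fst ⁻¹' U : Set (Cosphere 2)) := by
      ext z
      simp [cosphereIncl]
    rw [h5]
    exact ENNReal.ofReal_le_of_le_toReal (h3.trans h4)

end Limits

end FlatTorus

end

theorem theoremt :
    (∀ n : ℕ, 2 ≤ n → ∀ U : Set (FlatTorus.Torus n), IsOpen U → U.Nonempty →
      ∃ c : ℝ, 0 < c ∧ ∀ lam : ℝ, 0 ≤ lam → ∀ ψ : FlatTorus.Torus n → ℂ,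
        FlatTorus.IsNormalizedEigenfunction lam ψ → c ≤ ∫ x in U, ‖ψ x‖ ^ 2) ∧
    (∀ U : Set (FlatTorus.Torus 2), IsOpen U → U.Nonempty →
      ∃ c : ℝ, 0 < c ∧ ∀ μ ∈ FlatTorus.semiclassicalMeasures 2,
        ∃ m : Measure (FlatTorus.Cotangent 2), FlatTorus.Represents m μ ∧
          ENNReal.ofReal c ≤ m (U ×ˢ Metric.sphere (0 : FlatTorus.Euc 2) 1)) :=
  ⟨fun _ _ _ hU hne => FlatTorus.exists_lower_bound_of_isOpen hU hne,
    fun _ hU hne => FlatTorus.exists_represents_of_mem_semiclassicalMeasures hU hne⟩
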